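/- Let $M\ge 0$, $\varepsilon>0$, $0<k<1/\varepsilon$ and $r_0>2M$. A state is a pair $U=(\rho,v)$ with $\rho>0$ and $|v|<1/\varepsilon$. Put $$H(U)=\begin{pmatrix} r_0^2\,\frac{1+\varepsilon^4k^2v^2}{1-\varepsilon^2v^2}\,\rho\\[2pt] r_0(r_0-2M)\,\frac{1+\varepsilon^2k^2}{1-\varepsilon^2v^2}\,\rho v\end{pmatrix},\qquad F(U)=\begin{pmatrix} r_0(r_0-2M)\,\frac{1+\varepsilon^2k^2}{1-\varepsilon^2v^2}\,\rho v\\[2pt] (r_0-2M)^2\,\frac{v^2+k^2}{1-\varepsilon^2v^2}\,\rho\end{pmatrix},$$ $$\lambda(U)=\Big(1-\frac{2M}{r_0}\Big)\frac{v-k}{1-\varepsilon^2kv},\qquad \mu(U)=\Big(1-\frac{2M}{r_0}\Big)\frac{v+k}{1+\varepsilon^2kv},$$ $$w(U)=\frac1{2\varepsilon}\ln\frac{1+\varepsilon v}{1-\varepsilon v}+\frac{k}{1+\varepsilon^2k^2}\ln\rho,\qquad z(U)=\frac1{2\varepsilon}\ln\frac{1+\varepsilon v}{1-\varepsilon v}-\frac{k}{1+\varepsilon^2k^2}\ln\rho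 .$$ Two states $A$ (left) and $B$ (right) form a $1$-shock (resp. $2$-shock) of speed $s$ if $s\,(H(B)-H(A))=F(B)-F(A)$ and $\lambda(A)>s>\lambda(B)$ (resp. $\mu(A)>s>\mu(B)$). The $1$-wave curve $W_1^{\rightarrow}(U_L)$ consists of $U_L$, of all states $U$ such that $(U_L,U)$ is a $1$-shock of some speed, and of all states $U$ with $w(U)=w(U_L)$ and $\lambda(U)>\lambda(U_L)$. The backward $2$-wave curve $W_2^{\leftarrow}(U_R)$ consists of $U_R$, of all states $U$ such that $(U,U_R)$ is a $2$-shock of some speed, and of all states $U$ with $z(U)=z(U_R)$ and $\mu(U)<\mu(U_R)$. Then for all states $U_L,U_R$ the set $W_1^{\rightarrow}(U_L)\cap W_2^{\leftarrow}(U_R)$ consists of exactly one state $U_M$, and the Riemann problem $$\partial_tH(U)+\partial_rF(U)=0\quad(t>0,\ r\in\mathbb R),\qquad U(0,r)=U_L\ (r<r_0),\quad U(0,r)=U_R\ (r>r_0),$$ has an entropy weak solution of the form $U(t,r)=V\big((r-r_0)/t\big)$, i.e. a bounded solution in the sense of distributions (including the initial data) such that, at each point with $t>0$, $U$ either is continuous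 or has a jump whose one-sided limits form a $1$-shock or a $2$-shock with the speed of the jump curve. Moreover, there are $a_1\le b_1<a_2\le b_2$ such that $V=U_L$ on $(-\infty,a_1)$, $V=U_M$ on $(b_1,a_2)$, $V=U_R$ on $(b_2,\infty)$; either $a_1=b_1$ and $(U_L,U_M)$ is a $1$-shock of speed $a_1$, or $V$ is a $1$-rarefaction on $[a_1,b_1]$, that is, $a_1=\lambda(U_L)$, $b_1=\lambda(U_M)$, $w(U_M)=w(U_L)$, $V$ is smooth on $[a_1,b_1]$, and $w(V(y))=w(U_L)$, $\lambda(V(y))=y$ there (with $U_M=U_L$ when $a_1=b_1$: a wave of zero strength); and likewise $V$ is on $[a_2,b_2]$ a $2$-shock or a $2$-rarefaction from $U_M$ to $U_R$, with $\mu,z$ in place of $\lambda,w$. -/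

import Mathlib

open scoped ContDiff Topology

noncomputable section

namespace SchwarzschildFluid

/-- A fluid state `(ρ, v)`: mass density and scalar velocity. -/
abbrev State := ℝ × ℝ

/-- Physical states: positive density, velocity below the light speed `1 / ε`. -/
def Admissible (ε : ℝ) (U : State) : Prop :=
  0 < U.1 ∧ |U.2| < 1 / ε

/-- The conservative variables, evaluated at the frozen radius `r₀`. -/
def conserved (M ε k r₀ : ℝ) (U : State) : Fin 2 → ℝ :=
  ![r₀ ^ 2 * ((1 + ε ^ 4 * k ^ 2 * U.2 ^ 2) / (1 - ε ^ 2 * U.2 ^ 2)) * U.1,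
    r₀ * (r₀ - 2 * M) * ((1 + ε ^ 2 * k ^ 2) / (1 - ε ^ 2 * U.2 ^ 2)) * U.1 * U.2]

/-- The flux variables, evaluated at the frozen radius `r₀`. -/
def flux (M ε k r₀ : ℝ) (U : State) : Fin 2 → ℝ :=
  ![r₀ * (r₀ - 2 * M) * ((1 + ε ^ 2 * k ^ 2) / (1 - ε ^ 2 * U.2 ^ 2)) * U.1 * U.2,
    (r₀ - 2 * M) ^ 2 * ((U.2 ^ 2 + k ^ 2) / (1 - ε ^ 2 * U.2 ^ 2)) * U.1]

/-- The first wave speed `λ`. -/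
def speed₁ (M ε k r₀ : ℝ) (U : State) : ℝ :=
  (1 - 2 * M / r₀) * ((U.2 - k) / (1 - ε ^ 2 * k * U.2))

/-- The second wave speed `μ`. -/
def speed₂ (M ε k r₀ : ℝ) (U : State) : ℝ :=
  (1 - 2 * M / r₀) * ((U.2 + k) / (1 + ε ^ 2 * k * U.2))

/-- The Riemann invariant `w`, constant across 1-rarefactions. -/
def invW (ε k : ℝ) (U : State) : ℝ :=
  1 / (2 * ε) * Real.log ((1 + ε * U.2) / (1 - ε * U.2))
    + k / (1 + ε ^ 2 * k ^ 2) * Real.log U.1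

/-- The Riemann invariant `z`, constant across 2-rarefactions. -/
def invZ (ε k : ℝ) (U : State) : ℝ :=
  1 / (2 * ε) * Real.log ((1 + ε * U.2) / (1 - ε * U.2))
    - k / (1 + ε ^ 2 * k ^ 2) * Real.log U.1

/-- The Rankine-Hugoniot relations for a jump from `A` (left) to `B` (right) with speed `s`. -/
def RankineHugoniot (M ε k r₀ s : ℝ) (A B : State) : Prop :=
  ∀ i, s * (conserved M ε k r₀ B i - conserved M ε k r₀ A i) =
    flux M ε k r₀ B i - flux M ε k r₀ A i

/-- `A` (left) and `B` (right) are joined by a 1-shock of speed `s`: Rankine-Hugoniot relations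
and Lax shock inequalities for the first family. -/
def IsShock₁ (M ε k r₀ s : ℝ) (A B : State) : Prop :=
  RankineHugoniot M ε k r₀ s A B ∧ s < speed₁ M ε k r₀ A ∧ speed₁ M ε k r₀ B < s

/-- `A` (left) and `B` (right) are joined by a 2-shock of speed `s`. -/
def IsShock₂ (M ε k r₀ s : ℝ) (A B : State) : Prop :=
  RankineHugoniot M ε k r₀ s A B ∧ s < speed₂ M ε k r₀ A ∧ speed₂ M ε k r₀ B < s

/-- The 1-shock curve issuing from the left state `UL`. -/
def shockCurve₁ (M ε k r₀ : ℝ) (UL : State) : Set State :=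
  {U | Admissible ε U ∧ ∃ s, IsShock₁ M ε k r₀ s UL U}

/-- The backward 2-shock curve issuing from the right state `UR`. -/
def shockCurve₂ (M ε k r₀ : ℝ) (UR : State) : Set State :=
  {U | Admissible ε U ∧ ∃ s, IsShock₂ M ε k r₀ s U UR}

/-- The 1-rarefaction curve issuing from `UL`: `w` is constant and `λ` increases away
from `UL`. -/
def rarefactionCurve₁ (M ε k r₀ : ℝ) (UL : State) : Set State :=
  {U | Admissible ε U ∧ invW ε k U = invW ε k UL ∧ speed₁ M ε k r₀ UL < speed₁ M ε k r₀ U}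

/-- The backward 2-rarefaction curve issuing from `UR`: `z` is constant and `μ` decreases away
from `UR`. -/
def rarefactionCurve₂ (M ε k r₀ : ℝ) (UR : State) : Set State :=
  {U | Admissible ε U ∧ invZ ε k U = invZ ε k UR ∧ speed₂ M ε k r₀ U < speed₂ M ε k r₀ UR}

/-- The 1-wave curve through `UL` (the base point belongs to it). -/
def waveCurve₁ (M ε k r₀ : ℝ) (UL : State) : Set State :=
  {UL} ∪ shockCurve₁ M ε k r₀ UL ∪ rarefactionCurve₁ M ε k r₀ UL

/-- The backward 2-wave curve through `UR` (the base point belongs to it). -/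
def waveCurve₂ (M ε k r₀ : ℝ) (UR : State) : Set State :=
  {UR} ∪ shockCurve₂ M ε k r₀ UR ∪ rarefactionCurve₂ M ε k r₀ UR

/-- Riemann initial data with a jump at `r₀`. -/
def riemannData (r₀ : ℝ) (UL UR : State) (r : ℝ) : State :=
  if r < r₀ then UL else UR

/-- `U = U(t, r)`, `t > 0`, is a bounded weak solution of `∂ₜ H(U) + ∂ᵣ F(U) = 0` with initial
data `U₀` at `t = 0`, where `H` and `F` are the conservative and flux variables at radius `r₀`;
the test functions need not vanish at `t = 0`. -/
structure IsWeakSolution (M ε k r₀ : ℝ) (U₀ : ℝ → State) (U : ℝ → ℝ → State) : Prop where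
  admissible : ∀ t, 0 < t → ∀ r, Admissible ε (U t r)
  measurable : Measurable fun p : ℝ × ℝ => U p.1 p.2
  bounded : ∃ C, ∀ t, 0 < t → ∀ r, ∀ i,
    |conserved M ε k r₀ (U t r) i| ≤ C ∧ |flux M ε k r₀ (U t r) i| ≤ C
  weak : ∀ φ : ℝ × ℝ → ℝ, ContDiff ℝ ∞ φ → HasCompactSupport φ → ∀ i,
    (∫ p in Set.Ioi (0 : ℝ) ×ˢ (Set.univ : Set ℝ),
        (conserved M ε k r₀ (U p.1 p.2) i * fderiv ℝ φ p (1, 0)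
          + flux M ε k r₀ (U p.1 p.2) i * fderiv ℝ φ p (0, 1)))
      + ∫ r, conserved M ε k r₀ (U₀ r) i * φ (0, r) = 0

/-- At `(t, r)` the function `U` has a jump along a curve `x = γ(τ)` with speed `γ'(t)`, and its
one-sided limits form a 1-shock or a 2-shock. -/
def IsShockPoint (M ε k r₀ : ℝ) (U : ℝ → ℝ → State) (t r : ℝ) : Prop :=
  ∃ (γ : ℝ → ℝ) (s : ℝ) (A B : State), γ t = r ∧ HasDerivAt γ s t ∧
    Admissible ε A ∧ Admissible ε B ∧
    Filter.Tendsto (fun p : ℝ × ℝ => U p.1 p.2) (𝓝[{p | p.2 < γ p.1}] (t, r)) (𝓝 A) ∧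
    Filter.Tendsto (fun p : ℝ × ℝ => U p.1 p.2) (𝓝[{p | γ p.1 < p.2}] (t, r)) (𝓝 B) ∧
    (IsShock₁ M ε k r₀ s A B ∨ IsShock₂ M ε k r₀ s A B)

/-- Entropy weak solutions: weak solutions all of whose discontinuities at positive times are
shocks obeying the Lax inequalities. -/
structure IsEntropyWeakSolution (M ε k r₀ : ℝ) (U₀ : ℝ → State) (U : ℝ → ℝ → State) : Prop
    extends IsWeakSolution M ε k r₀ U₀ U where
  entropy : ∀ t, 0 < t → ∀ r,
    ContinuousAt (fun p : ℝ × ℝ => U p.1 p.2) (t, r) ∨ IsShockPoint M ε k r₀ U t r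

/-- On the interval `[a, b]` of the similarity variable, the profile `V` is a smooth centered
rarefaction from `A` to `B` for the wave speed `c` and the Riemann invariant `I`. The case
`a = b`, `A = B` is the wave of zero strength. -/
def IsRarefactionFan (ε : ℝ) (c I : State → ℝ) (A B : State) (a b : ℝ) (V : ℝ → State) : Prop :=
  c A = a ∧ c B = b ∧ a ≤ b ∧ I B = I A ∧ ContDiffOn ℝ ∞ V (Set.Icc a b) ∧
    ∀ y ∈ Set.Icc a b, Admissible ε (V y) ∧ I (V y) = I A ∧ c (V y) = y

/-- On `[a, b]` the profile `V` is a 1-wave from `A` to `B`: a shock or a rarefaction. -/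
def IsWave₁ (M ε k r₀ : ℝ) (A B : State) (a b : ℝ) (V : ℝ → State) : Prop :=
  (a = b ∧ IsShock₁ M ε k r₀ a A B) ∨
    IsRarefactionFan ε (speed₁ M ε k r₀) (invW ε k) A B a b V

/-- On `[a, b]` the profile `V` is a 2-wave from `A` to `B`: a shock or a rarefaction. -/
def IsWave₂ (M ε k r₀ : ℝ) (A B : State) (a b : ℝ) (V : ℝ → State) : Prop :=
  (a = b ∧ IsShock₂ M ε k r₀ a A B) ∨
    IsRarefactionFan ε (speed₂ M ε k r₀) (invZ ε k) A B a b V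

/-- The profile `V` consists of the constant states `UL`, `UM`, `UR`, separated by a 1-wave on
`[a₁, b₁]` and a faster 2-wave on `[a₂, b₂]`. -/
def IsRiemannFan (M ε k r₀ : ℝ) (UL UM UR : State) (V : ℝ → State) : Prop :=
  ∃ a₁ b₁ a₂ b₂ : ℝ, a₁ ≤ b₁ ∧ b₁ < a₂ ∧ a₂ ≤ b₂ ∧
    (∀ y < a₁, V y = UL) ∧ (∀ y ∈ Set.Ioo b₁ a₂, V y = UM) ∧ (∀ y > b₂, V y = UR) ∧
    IsWave₁ M ε k r₀ UL UM a₁ b₁ V ∧ IsWave₂ M ε k r₀ UM UR a₂ b₂ V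

end SchwarzschildFluid

end

/-! Everything becomes explicit in Doppler factors E = (1 + εv)/(1 - εv), because relativistic
addition of velocities is multiplication of factors. If m is the factor of the sound speed k, then λ
and μ have factors E/m and Em, up to the constant 1 - 2M/r₀. The components of H and F are linear in
ρE, ρ/E and ρ, and the Rankine-Hugoniot relations with speed factor S decouple (`jump_iff`) into (m²
+ 1)[ρE] = 2mS[ρ] and (m² + 1)S[ρ/E] = 2m[ρ].

Let ξ be the jump of ln ρ and Δ the jump of the rapidity (1/2) ln E. Eliminating S gives sinh²Δ =
(2K sinh(ξ/2))² with 2K = (m² - 1)/(m² + 1), and the Lax inequalities for the first family select ξ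
> 0 > Δ (`shock_necessary`, `shock_sufficient`, `hugoniot_iff`). Constancy of w reads Δ = -Kξ with
the same K, and λ increases exactly when ξ < 0. So the 1-wave curve is the graph Δ = -f(ξ), where f
= `waveFun K` is a continuous increasing bijection of ℝ (`mem_waveCurve₁_iff`). Reflection of the
velocity exchanges the two families, so the backward 2-wave curve is the graph Δ = f(ξ) about the
right state. A decreasing and an increasing graph, both unbounded in both directions, meet exactly
once (`exists_inter_waveCurves`).

A profile V((r - r₀)/t) is a weak solution once g(y) = F(V) - yH(V) is continuous and g' = -H(V) off
a countable set: the integral of H(V)φ over r then has t-derivative equal to the integral of H(V)φ_t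
+ F(V)φ_r, and one integrates over t > 0 (`weak_of_selfSimilar`). For a shock, continuity of g is
the Rankine-Hugoniot relation; for a fan, the equation for g is the infinitesimal form of the same
relation, again solved by `jump_iff`. Finally, every 1-wave ends strictly below the coordinate
velocity (1 - 2M/r₀)v of its right state, and every 2-wave starts strictly above that of its left
state, so the two waves can be glued along the middle state (`exists_wave₁`, `exists_wave₂`,
`IsSelfSimilarSolution.glue`). -/

noncomputable section

namespace SchwarzschildFluid

variable {M ε k r₀ : ℝ}

/-! ### Doppler factors and wave speeds -/

/-- The Doppler factor `(1 + ε v) / (1 - ε v)` of a velocity. -/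
def doppler (ε v : ℝ) : ℝ := (1 + ε * v) / (1 - ε * v)

/-- The coordinate speed `(1 - 2M/r₀) v` of the velocity `v` with Doppler factor `S`. -/
def velocity (M ε r₀ S : ℝ) : ℝ := (1 - 2 * M / r₀) / ε * ((S - 1) / (S + 1))

/-- The energy density as a linear function of `ρ E`, `ρ / E`, `ρ`, where `E` is the Doppler factor
of the fluid and `m` that of the sound speed. -/
def energy (m u l r : ℝ) : ℝ := ((m ^ 2 + 1) * (u + l) + 4 * m * r) / (2 * (m + 1) ^ 2)

/-- The momentum density as a linear function of `ρ E`, `ρ / E`. -/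
def momentum (m u l : ℝ) : ℝ := (m ^ 2 + 1) * (u - l) / (2 * (m + 1) ^ 2)

/-- The momentum flux as a linear function of `ρ E`, `ρ / E`, `ρ`. -/
def stress (m u l r : ℝ) : ℝ := ((m ^ 2 + 1) * (u + l) - 4 * m * r) / (2 * (m + 1) ^ 2)

theorem abs_mul_lt_one (hε : 0 < ε) {v : ℝ} (hv : |v| < 1 / ε) : -1 < ε * v ∧ ε * v < 1 := by
  rw [lt_div_iff₀ hε] at hv
  exact abs_lt.mp (by rw [abs_mul, abs_of_pos hε]; linarith)

theorem doppler_pos (hε : 0 < ε) {v : ℝ} (hv : |v| < 1 / ε) : 0 < doppler ε v := by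
  obtain ⟨h1, h2⟩ := abs_mul_lt_one hε hv
  exact div_pos (by linarith) (by linarith)

theorem doppler_neg (v : ℝ) : doppler ε (-v) = (doppler ε v)⁻¹ := by
  simp [doppler, sub_eq_add_neg]

theorem one_lt_doppler (hε : 0 < ε) (hk : 0 < k) (hkε : k < 1 / ε) : 1 < doppler ε k := by
  have := (abs_mul_lt_one hε (v := k) (by rwa [abs_of_pos hk])).2
  have := mul_pos hε hk
  rw [doppler, one_lt_div] <;> linarith

/-- The velocity with Doppler factor `E`. -/
def undoppler (ε E : ℝ) : ℝ := (E - 1) / (ε * (E + 1))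

theorem undoppler_doppler (hε : 0 < ε) {v : ℝ} (hv : |v| < 1 / ε) :
    undoppler ε (doppler ε v) = v := by
  obtain ⟨h1, h2⟩ := abs_mul_lt_one hε hv
  have : 1 - ε * v ≠ 0 := by linarith
  rw [undoppler, doppler]
  field_simp
  ring_nf

theorem doppler_undoppler (hε : 0 < ε) {E : ℝ} (hE : 0 < E) : doppler ε (undoppler ε E) = E := by
  have : E + 1 ≠ 0 := by linarith
  rw [undoppler, doppler]
  field_simp
  ring_nf

theorem abs_undoppler_lt (hε : 0 < ε) {E : ℝ} (hE : 0 < E) : |undoppler ε E| < 1 / ε := by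
  have : 0 < E + 1 := by linarith
  rw [undoppler, abs_lt, ← neg_div, div_lt_div_iff₀ hε (by positivity),
    div_lt_div_iff₀ (by positivity) hε]
  constructor <;> nlinarith

theorem velocity_lt_iff (hε : 0 < ε) (hη : 0 < 1 - 2 * M / r₀) {S T : ℝ} (hS : 0 < S)
    (hT : 0 < T) : velocity M ε r₀ S < velocity M ε r₀ T ↔ S < T := by
  rw [velocity, velocity, mul_lt_mul_iff_right₀ (by positivity),
    div_lt_div_iff₀ (by linarith) (by linarith)]
  constructor <;> intro h <;> linarith

theorem velocity_doppler (hε : 0 < ε) {v : ℝ} (hv : |v| < 1 / ε) :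
    velocity M ε r₀ (doppler ε v) = (1 - 2 * M / r₀) * v := by
  obtain ⟨h1, h2⟩ := abs_mul_lt_one hε hv
  have : 1 - ε * v ≠ 0 := by linarith
  have : 1 + ε * v + (1 - ε * v) ≠ 0 := by linarith
  have : (doppler ε v - 1) / (doppler ε v + 1) = ε * v := by
    rw [doppler]
    field_simp
    ring
  rw [velocity, this]
  field_simp

/-- The Doppler factor of a coordinate speed. -/
def speedFactor (M ε r₀ y : ℝ) : ℝ := (1 - 2 * M / r₀ + ε * y) / (1 - 2 * M / r₀ - ε * y)

theorem velocity_bounds (hε : 0 < ε) (hη : 0 < 1 - 2 * M / r₀) {S : ℝ} (hS : 0 < S) :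
    -(1 - 2 * M / r₀) < ε * velocity M ε r₀ S ∧ ε * velocity M ε r₀ S < 1 - 2 * M / r₀ := by
  have : ε * velocity M ε r₀ S = (1 - 2 * M / r₀) * ((S - 1) / (S + 1)) := by
    rw [velocity]; field_simp
  rw [this]
  have h1 : -1 < (S - 1) / (S + 1) := by rw [lt_div_iff₀] <;> linarith
  have h2 : (S - 1) / (S + 1) < 1 := by rw [div_lt_iff₀] <;> linarith
  constructor <;> nlinarith

theorem speedFactor_velocity (hε : 0 < ε) (hη : 0 < 1 - 2 * M / r₀) {S : ℝ} (hS : 0 < S) :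
    speedFactor M ε r₀ (velocity M ε r₀ S) = S := by
  have h : ε * velocity M ε r₀ S = (1 - 2 * M / r₀) * ((S - 1) / (S + 1)) := by
    rw [velocity]; field_simp
  rw [speedFactor, h]
  generalize 1 - 2 * M / r₀ = η at hη
  have : S + 1 ≠ 0 := by linarith
  have : η - η * ((S - 1) / (S + 1)) = 2 * η / (S + 1) := by field_simp; ring
  rw [this]
  field_simp
  ring

theorem speedFactor_pos {y : ℝ} (h1 : -(1 - 2 * M / r₀) < ε * y) (h2 : ε * y < 1 - 2 * M / r₀) :
    0 < speedFactor M ε r₀ y := div_pos (by linarith) (by linarith)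

theorem velocity_speedFactor (hε : 0 < ε) (hη : 0 < 1 - 2 * M / r₀) {y : ℝ}
    (h2 : ε * y < 1 - 2 * M / r₀) :
    velocity M ε r₀ (speedFactor M ε r₀ y) = y := by
  rw [speedFactor, velocity]
  generalize 1 - 2 * M / r₀ = η at *
  have : η - ε * y ≠ 0 := by linarith
  have h3 : (η + ε * y) / (η - ε * y) + 1 = 2 * η / (η - ε * y) := by field_simp; ring
  rw [h3]
  field_simp
  ring

/-- Relativistic subtraction of the sound speed divides the Doppler factor of the fluid by that of
sound. -/
theorem speed₁_eq (hε : 0 < ε) (hk : 0 < k) (hkε : k < 1 / ε) {U : State}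
    (hU : Admissible ε U) :
    speed₁ M ε k r₀ U = velocity M ε r₀ (doppler ε U.2 / doppler ε k) := by
  obtain ⟨h1, h2⟩ := abs_mul_lt_one hε hU.2
  obtain ⟨h3, h4⟩ := abs_mul_lt_one hε (v := k) (by rwa [abs_of_pos hk])
  have h5 : 0 < 1 + ε * k := by linarith
  have h6 : 0 < 1 - ε * k := by linarith
  have h7 : 0 < 1 + ε * U.2 := by linarith
  have h8 : 0 < 1 - ε * U.2 := by linarith
  have h9 : 0 < 1 - ε ^ 2 * k * U.2 := by nlinarith
  have : doppler ε U.2 / doppler ε k + 1 =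
      2 * (1 - ε ^ 2 * k * U.2) / ((1 - ε * U.2) * (1 + ε * k)) := by
    rw [doppler, doppler]; field_simp; ring
  rw [speed₁, velocity, this]
  have : doppler ε U.2 / doppler ε k - 1 =
      2 * ε * (U.2 - k) / ((1 - ε * U.2) * (1 + ε * k)) := by
    rw [doppler, doppler]; field_simp; ring
  rw [this]
  generalize 1 - 2 * M / r₀ = η
  rw [div_div_div_cancel_right₀ (by positivity)]
  field_simp

theorem speed₂_neg (U : State) :
    speed₂ M ε k r₀ U = -speed₁ M ε k r₀ (U.1, -U.2) := by
  have : 1 - ε ^ 2 * k * -U.2 = 1 + ε ^ 2 * k * U.2 := by ring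
  simp only [speed₂, speed₁, this]
  rw [show -U.2 - k = -(U.2 + k) by ring, neg_div]
  ring

/-! ### The conservation law in light-cone variables -/

theorem conserved_zero_eq (hε : 0 < ε) (hk : 0 < k) (hkε : k < 1 / ε) {U : State}
    (hU : Admissible ε U) :
    conserved M ε k r₀ U 0 = r₀ ^ 2 * energy (doppler ε k) (U.1 * doppler ε U.2)
      (U.1 / doppler ε U.2) U.1 := by
  have hE := doppler_pos hε hU.2
  have hm := one_lt_doppler hε hk hkε
  have hv := undoppler_doppler hε hU.2
  have hk' := undoppler_doppler hε (v := k) (by rwa [abs_of_pos hk])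
  simp only [conserved, Matrix.cons_val_zero]
  generalize doppler ε U.2 = E at *
  generalize doppler ε k = m at *
  -- Writing both velocities through their Doppler factors turns the claim into an identity of
  -- rational functions of E and m.
  rw [← hv, ← hk', energy, undoppler, undoppler]
  have h0 : 1 - ε ^ 2 * ((E - 1) / (ε * (E + 1))) ^ 2 = 4 * E / (E + 1) ^ 2 := by
    field_simp; ring
  rw [h0]
  have : m + 1 ≠ 0 := by linarith
  field_simp
  ring

theorem flux_zero_eq (hε : 0 < ε) (hk : 0 < k) (hkε : k < 1 / ε) {U : State}
    (hU : Admissible ε U) :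
    flux M ε k r₀ U 0 = r₀ * (r₀ - 2 * M) / ε * momentum (doppler ε k) (U.1 * doppler ε U.2)
      (U.1 / doppler ε U.2) := by
  have hE := doppler_pos hε hU.2
  have hm := one_lt_doppler hε hk hkε
  have hv := undoppler_doppler hε hU.2
  have hk' := undoppler_doppler hε (v := k) (by rwa [abs_of_pos hk])
  simp only [flux, Matrix.cons_val_zero]
  generalize doppler ε U.2 = E at *
  generalize doppler ε k = m at *
  rw [← hv, ← hk', momentum, undoppler, undoppler]
  have h0 : 1 - ε ^ 2 * ((E - 1) / (ε * (E + 1))) ^ 2 = 4 * E / (E + 1) ^ 2 := by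
    field_simp; ring
  rw [h0]
  have : m + 1 ≠ 0 := by linarith
  field_simp
  ring

theorem conserved_one_eq_flux_zero (U : State) :
    conserved M ε k r₀ U 1 = flux M ε k r₀ U 0 := by
  simp [conserved, flux]

theorem flux_one_eq (hε : 0 < ε) (hk : 0 < k) (hkε : k < 1 / ε) {U : State}
    (hU : Admissible ε U) :
    flux M ε k r₀ U 1 = (r₀ - 2 * M) ^ 2 / ε ^ 2 * stress (doppler ε k) (U.1 * doppler ε U.2)
      (U.1 / doppler ε U.2) U.1 := by
  have hE := doppler_pos hε hU.2
  have hm := one_lt_doppler hε hk hkε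
  have hv := undoppler_doppler hε hU.2
  have hk' := undoppler_doppler hε (v := k) (by rwa [abs_of_pos hk])
  simp only [flux, Matrix.cons_val_one]
  generalize doppler ε U.2 = E at *
  generalize doppler ε k = m at *
  have : m + 1 ≠ 0 := by linarith
  rw [← hv, ← hk', stress, undoppler, undoppler]
  have h0 : 1 - ε ^ 2 * ((E - 1) / (ε * (E + 1))) ^ 2 = 4 * E / (E + 1) ^ 2 := by
    field_simp; ring
  rw [h0]
  simp only [Matrix.cons_val_fin_one]
  field_simp
  ring

/-- The Rankine-Hugoniot relations, or their infinitesimal version, in light-cone variables. -/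
theorem jump_iff (hε : 0 < ε) (hr : 0 < r₀) (hr₀ : 2 * M < r₀) {m S : ℝ} (hm : 1 < m)
    (hS : 0 < S) (u l r : ℝ) :
    (velocity M ε r₀ S * (r₀ ^ 2 * energy m u l r) = r₀ * (r₀ - 2 * M) / ε * momentum m u l ∧
      velocity M ε r₀ S * (r₀ * (r₀ - 2 * M) / ε * momentum m u l) =
        (r₀ - 2 * M) ^ 2 / ε ^ 2 * stress m u l r) ↔
    ((m ^ 2 + 1) * u = 2 * m * S * r ∧ (m ^ 2 + 1) * S * l = 2 * m * r) := by
  have hd : 0 < r₀ - 2 * M := by linarith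
  have hS1 : S + 1 ≠ 0 := by linarith
  have hm1 : m + 1 ≠ 0 := by linarith
  have hv : velocity M ε r₀ S = (r₀ - 2 * M) / (r₀ * ε) * ((S - 1) / (S + 1)) := by
    rw [velocity]; field_simp
  have e1 : velocity M ε r₀ S * (r₀ ^ 2 * energy m u l r) =
      r₀ * (r₀ - 2 * M) / ε * momentum m u l ↔
      (S - 1) * ((m ^ 2 + 1) * (u + l) + 4 * m * r) = (S + 1) * ((m ^ 2 + 1) * (u - l)) := by
    rw [hv, energy, momentum]
    generalize r₀ - 2 * M = d at *
    field_simp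
  have e2 : velocity M ε r₀ S * (r₀ * (r₀ - 2 * M) / ε * momentum m u l) =
        (r₀ - 2 * M) ^ 2 / ε ^ 2 * stress m u l r ↔
      (S - 1) * ((m ^ 2 + 1) * (u - l)) = (S + 1) * ((m ^ 2 + 1) * (u + l) - 4 * m * r) := by
    rw [hv, stress, momentum]
    generalize r₀ - 2 * M = d at *
    field_simp
  rw [e1, e2]
  -- The sum of the two relations contains only u and r, their difference only l and r.
  constructor
  · rintro ⟨h1, h2⟩
    constructor <;> linarith
  · rintro ⟨h1, h2⟩
    constructor <;> linarith

theorem rankineHugoniot_iff (hε : 0 < ε) (hk : 0 < k) (hkε : k < 1 / ε) (hr : 0 < r₀)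
    (hr₀ : 2 * M < r₀) {S : ℝ} (hS : 0 < S) {A B : State} (hA : Admissible ε A)
    (hB : Admissible ε B) :
    RankineHugoniot M ε k r₀ (velocity M ε r₀ S) A B ↔
      ((doppler ε k ^ 2 + 1) * (B.1 * doppler ε B.2 - A.1 * doppler ε A.2)
          = 2 * doppler ε k * S * (B.1 - A.1) ∧
        (doppler ε k ^ 2 + 1) * S * (B.1 / doppler ε B.2 - A.1 / doppler ε A.2)
          = 2 * doppler ε k * (B.1 - A.1)) := by
  rw [← jump_iff hε hr hr₀ (one_lt_doppler hε hk hkε) hS, RankineHugoniot, Fin.forall_fin_two,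
    conserved_one_eq_flux_zero, conserved_one_eq_flux_zero, conserved_zero_eq hε hk hkε hA,
    conserved_zero_eq hε hk hkε hB, flux_zero_eq hε hk hkε hA, flux_zero_eq hε hk hkε hB,
    flux_one_eq hε hk hkε hA, flux_one_eq hε hk hkε hB]
  have e1 (m u l r u' l' r' : ℝ) : energy m (u' - u) (l' - l) (r' - r) =
    energy m u' l' r' - energy m u l r := by simp only [energy]; ring
  have e2 (m u l u' l' : ℝ) : momentum m (u' - u) (l' - l) =
    momentum m u' l' - momentum m u l := by simp only [momentum]; ring
  have e3 (m u l r u' l' r' : ℝ) : stress m (u' - u) (l' - l) (r' - r) =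
    stress m u' l' r' - stress m u l r := by simp only [stress]; ring
  simp only [e1, e2, e3, mul_sub]

/-! ### Algebra of Lax shocks -/

/-- Compression, deceleration and the speed bound behind a Lax 1-shock, with density ratio `x`,
ratio `e` of the Doppler factors and relative speed factor `S`. -/
theorem shock_necessary {m x e S : ℝ} (hm : 1 < m) (hx : 0 < x) (he : 0 < e) (hS : 0 < S)
    (h1 : (m ^ 2 + 1) * (x * e - 1) = 2 * m * S * (x - 1))
    (h2 : (m ^ 2 + 1) * S * (x / e - 1) = 2 * m * (x - 1)) (hl : m * S < 1) (hr : e < m * S) :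
    1 < x ∧ e < 1 ∧ S < e ∧
      (m ^ 2 + 1) ^ 2 * ((1 - e) ^ 2 * x) = (m ^ 2 - 1) ^ 2 * ((x - 1) ^ 2 * e) := by
  have he1 : e < 1 := hr.trans hl
  have h2' : (m ^ 2 + 1) * S * (x - e) = 2 * m * (x - 1) * e := by
    have : x / e - 1 = (x - e) / e := by field_simp
    rw [this] at h2
    field_simp at h2
    linarith
  -- If x ≤ 1, then (m² + 1)(1 - xe) ≤ 2(1 - x) ≤ 2(1 - xe), which is absurd because m² + 1 > 2 and
  -- xe < 1.
  have hx1 : 1 < x := by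
    by_contra hx1
    push Not at hx1
    have a1 : (m ^ 2 + 1) * (1 - x * e) = 2 * (m * S) * (1 - x) := by linarith
    have a2 : 2 * (m * S) * (1 - x) ≤ 2 * (1 - x) := by nlinarith
    have a3 : 2 * (1 - x * e) < (m ^ 2 + 1) * (1 - x * e) := by
      have : 0 < 1 - x * e := by nlinarith
      have : 2 < m ^ 2 + 1 := by nlinarith
      gcongr
    nlinarith
  refine ⟨hx1, he1, ?_, ?_⟩
  -- If e ≤ S, the second relation gives (m² + 1)(x - e) ≤ 2m(x - 1) ≤ (m² + 1)(x - 1),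
  -- contradicting e < 1.
  · by_contra hSe
    push Not at hSe
    have a1 : (m ^ 2 + 1) * e * (x - e) ≤ (m ^ 2 + 1) * S * (x - e) := by
      have : 0 < x - e := by linarith
      gcongr
    have a2 : (m ^ 2 + 1) * (x - e) ≤ 2 * m * (x - 1) := by
      rw [h2'] at a1
      exact le_of_mul_le_mul_right (by linarith) he
    have a3 : 2 * m * (x - 1) ≤ (m ^ 2 + 1) * (x - 1) := by
      have : 0 < x - 1 := by linarith
      have : 0 ≤ (m - 1) ^ 2 * (x - 1) := by positivity
      linarith
    have : (m ^ 2 + 1) * (x - 1) < (m ^ 2 + 1) * (x - e) := by gcongr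
    linarith
  -- Multiplying the two relations eliminates S. The final form uses (xe - 1)(x - e) = (x - 1)²e -
  -- (1 - e)²x and (m² + 1)² - (m² - 1)² = 4m².
  · have a : (m ^ 2 + 1) ^ 2 * (x * e - 1) * (x - e) = 4 * m ^ 2 * (x - 1) ^ 2 * e := by
      have : S * ((m ^ 2 + 1) ^ 2 * (x * e - 1) * (x - e)) =
          S * (4 * m ^ 2 * (x - 1) ^ 2 * e) := by
        calc _ = ((m ^ 2 + 1) * (x * e - 1)) * ((m ^ 2 + 1) * S * (x - e)) := by ring
          _ = _ := by rw [h1, h2']; ring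
      exact mul_left_cancel₀ hS.ne' this
    linear_combination (-1) * a

/-- The first Rankine-Hugoniot relation dictates S; the second is then the Hugoniot relation. If
either Lax inequality failed, squaring it and comparing with the Hugoniot relation would give xe ≤
1, whereas that relation forces xe > 1. -/
theorem shock_sufficient {m x e : ℝ} (hm : 1 < m) (hx : 1 < x) (he : 0 < e) (he1 : e < 1)
    (h : (m ^ 2 + 1) ^ 2 * ((1 - e) ^ 2 * x) = (m ^ 2 - 1) ^ 2 * ((x - 1) ^ 2 * e)) :
    ∃ S, 0 < S ∧ (m ^ 2 + 1) * (x * e - 1) = 2 * m * S * (x - 1) ∧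
      (m ^ 2 + 1) * S * (x / e - 1) = 2 * m * (x - 1) ∧ m * S < 1 ∧ e < m * S := by
  have hx1 : 0 < x - 1 := by linarith
  have hxe : 0 < x - e := by linarith
  have hm0 : 0 < m := by linarith
  have hm1 : 0 < m ^ 2 - 1 := by nlinarith
  have a : (m ^ 2 + 1) ^ 2 * (x * e - 1) * (x - e) = 4 * m ^ 2 * (x - 1) ^ 2 * e := by
    linear_combination (-1) * h
  have hy : 0 < x * e - 1 := by
    have : 0 < (m ^ 2 + 1) ^ 2 * (x - e) * (x * e - 1) := by
      have : 0 < 4 * m ^ 2 * (x - 1) ^ 2 * e := by positivity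
      linarith
    exact pos_of_mul_pos_right this (by positivity)
  refine ⟨(m ^ 2 + 1) * (x * e - 1) / (2 * m * (x - 1)), by positivity, by field_simp, ?_, ?_, ?_⟩
  · have : x / e - 1 = (x - e) / e := by field_simp
    rw [this]
    field_simp
    linear_combination a
  · have : m * ((m ^ 2 + 1) * (x * e - 1) / (2 * m * (x - 1))) =
        (m ^ 2 + 1) * (x * e - 1) / (2 * (x - 1)) := by field_simp
    rw [this, div_lt_one (by positivity)]
    by_contra hc
    push Not at hc
    have b1 : (m ^ 2 + 1) * x * (1 - e) ≤ (m ^ 2 - 1) * (x - 1) := by linarith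
    have b2 : ((m ^ 2 + 1) * x * (1 - e)) ^ 2 ≤ ((m ^ 2 - 1) * (x - 1)) ^ 2 := by
      have : 0 < 1 - e := by linarith
      gcongr
    have b3 : ((m ^ 2 + 1) * x * (1 - e)) ^ 2 = ((m ^ 2 - 1) * (x - 1)) ^ 2 * (x * e) := by
      linear_combination x * h
    have : 0 < ((m ^ 2 - 1) * (x - 1)) ^ 2 * (x * e - 1) := by positivity
    linarith
  · have : m * ((m ^ 2 + 1) * (x * e - 1) / (2 * m * (x - 1))) =
        (m ^ 2 + 1) * (x * e - 1) / (2 * (x - 1)) := by field_simp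
    rw [this, lt_div_iff₀ (by positivity)]
    by_contra hc
    push Not at hc
    have b1 : (m ^ 2 - 1) * e * (x - 1) ≤ (m ^ 2 + 1) * (1 - e) := by linarith
    have b2 : ((m ^ 2 - 1) * e * (x - 1)) ^ 2 * x ≤ ((m ^ 2 + 1) * (1 - e)) ^ 2 * x := by
      gcongr
    have b3 : ((m ^ 2 + 1) * (1 - e)) ^ 2 * x = ((m ^ 2 - 1) * (x - 1)) ^ 2 * e := by
      linear_combination h
    have : 0 < ((m ^ 2 - 1) * (x - 1)) ^ 2 * (x * e - 1) * e := by positivity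
    linarith

/-! ### Shocks in terms of rapidity and logarithmic density -/

/-- The rapidity of a state. -/
def rapidity (ε : ℝ) (U : State) : ℝ := 1 / 2 * Real.log (doppler ε U.2)

/-- The exponent `ε k / (1 + ε² k²)` of the rarefaction curves. -/
def slope (ε k : ℝ) : ℝ := ε * k / (1 + ε ^ 2 * k ^ 2)

theorem slope_pos (hε : 0 < ε) (hk : 0 < k) : 0 < slope ε k := by
  rw [slope]; positivity

/-- The exponent of the rarefaction curves is also the constant of the Hugoniot curve, so one
parameter K governs both halves of a wave curve. -/
theorem slope_eq (hε : 0 < ε) (hk : 0 < k) (hkε : k < 1 / ε) :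
    2 * slope ε k = (doppler ε k ^ 2 - 1) / (doppler ε k ^ 2 + 1) := by
  have hm := one_lt_doppler hε hk hkε
  have hk' := undoppler_doppler hε (v := k) (by rwa [abs_of_pos hk])
  generalize doppler ε k = m at *
  have : m + 1 ≠ 0 := by linarith
  rw [slope, ← hk', undoppler]
  have : 1 + ε ^ 2 * ((m - 1) / (ε * (m + 1))) ^ 2 = 2 * (m ^ 2 + 1) / (m + 1) ^ 2 := by
    field_simp; ring
  rw [this]
  field_simp
  ring

theorem invW_eq (hε : 0 < ε) (U : State) :
    invW ε k U = (rapidity ε U + slope ε k * Real.log U.1) / ε := by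
  rw [invW, rapidity, slope, doppler]
  field_simp

theorem four_mul_sinh_sq (a : ℝ) :
    4 * Real.sinh a ^ 2 * Real.exp (2 * a) = (1 - Real.exp (2 * a)) ^ 2 := by
  have h1 : Real.exp (2 * a) = Real.exp a ^ 2 := by rw [← Real.exp_nat_mul]; norm_num
  have h2 : Real.exp (-a) * Real.exp a = 1 := by rw [← Real.exp_add]; simp
  rw [Real.sinh_eq, h1]
  linear_combination (Real.exp a * Real.exp (-a) - 2 * Real.exp a ^ 2 + 1) * h2

/-- Since (1 - e)² = 4e sinh²Δ and (1 - x)² = 4x sinh²(ξ/2), the Hugoniot relation is an equality of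
two squares; compression together with deceleration fixes the sign of the root. -/
theorem hugoniot_iff {m x e K Δ ξ : ℝ} (hm : 1 < m) (hK : 2 * K = (m ^ 2 - 1) / (m ^ 2 + 1))
    (he : Real.exp (2 * Δ) = e) (hx : Real.exp ξ = x) :
    (1 < x ∧ e < 1 ∧
      (m ^ 2 + 1) ^ 2 * ((1 - e) ^ 2 * x) = (m ^ 2 - 1) ^ 2 * ((x - 1) ^ 2 * e)) ↔
    0 < ξ ∧ Real.sinh Δ = -(2 * K * Real.sinh (ξ / 2)) := by
  have h1 : 1 < x ↔ 0 < ξ := by rw [← hx, Real.one_lt_exp_iff]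
  have h2 : e < 1 ↔ Δ < 0 := by
    rw [← he, Real.exp_lt_one_iff]; constructor <;> intro h <;> linarith
  have h3 := four_mul_sinh_sq Δ
  have h4 := four_mul_sinh_sq (ξ / 2)
  rw [mul_div_cancel₀ ξ two_ne_zero, hx] at h4
  rw [he] at h3
  have hx0 : 0 < x := hx ▸ Real.exp_pos _
  have he0 : 0 < e := he ▸ Real.exp_pos _
  have hK0 : 0 < 2 * K := by
    rw [hK]
    have : 0 < m ^ 2 - 1 := by nlinarith
    positivity
  have h5 : (m ^ 2 + 1) ^ 2 * ((1 - e) ^ 2 * x) = (m ^ 2 - 1) ^ 2 * ((x - 1) ^ 2 * e) ↔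
      Real.sinh Δ ^ 2 = (-(2 * K * Real.sinh (ξ / 2))) ^ 2 := by
    have : (m ^ 2 - 1) = 2 * K * (m ^ 2 + 1) := by rw [hK]; field_simp
    rw [this, show (x - 1) ^ 2 = (1 - x) ^ 2 by ring, ← h3, ← h4]
    have hp : 0 < 4 * (m ^ 2 + 1) ^ 2 * x * e := by positivity
    constructor
    · intro h
      exact mul_left_cancel₀ hp.ne' (by linear_combination h)
    · intro h
      linear_combination 4 * (m ^ 2 + 1) ^ 2 * x * e * h
  rw [h1, h2, h5]
  constructor
  · rintro ⟨a, b, c⟩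
    refine ⟨a, ?_⟩
    have hs : 0 < Real.sinh (ξ / 2) := Real.sinh_pos_iff.mpr (by linarith)
    have hd : Real.sinh Δ < 0 := Real.sinh_neg_iff.mpr b
    rcases sq_eq_sq_iff_eq_or_eq_neg.mp c with c | c
    · exact c
    · have := mul_pos hK0 hs
      linarith
  · rintro ⟨a, b⟩
    have hs : 0 < Real.sinh (ξ / 2) := Real.sinh_pos_iff.mpr (by linarith)
    have := mul_pos hK0 hs
    exact ⟨a, Real.sinh_neg_iff.mp (by linarith), by rw [b]⟩

theorem exp_rapidity_sub (hε : 0 < ε) {A B : State} (hA : Admissible ε A)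
    (hB : Admissible ε B) :
    Real.exp (2 * (rapidity ε B - rapidity ε A)) = doppler ε B.2 / doppler ε A.2 := by
  rw [rapidity, rapidity, show 2 * (1 / 2 * Real.log (doppler ε B.2)
    - 1 / 2 * Real.log (doppler ε A.2)) = Real.log (doppler ε B.2) - Real.log (doppler ε A.2)
    by ring, Real.exp_sub, Real.exp_log (doppler_pos hε hB.2), Real.exp_log (doppler_pos hε hA.2)]

theorem exp_log_sub {a b : ℝ} (ha : 0 < a) (hb : 0 < b) :
    Real.exp (Real.log b - Real.log a) = b / a := by
  rw [Real.exp_sub, Real.exp_log hb, Real.exp_log ha]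

/-- The relations are homogeneous in the density and invariant under boosts, which multiply E and S
by a common factor. Hence only the ratios to the left state matter. -/
theorem rankineHugoniot_iff_ratio (hε : 0 < ε) (hk : 0 < k) (hkε : k < 1 / ε) (hr : 0 < r₀)
    (hr₀ : 2 * M < r₀) {S : ℝ} (hS : 0 < S) {A B : State} (hA : Admissible ε A)
    (hB : Admissible ε B) :
    RankineHugoniot M ε k r₀ (velocity M ε r₀ (S * doppler ε A.2)) A B ↔
      ((doppler ε k ^ 2 + 1) * (B.1 / A.1 * (doppler ε B.2 / doppler ε A.2) - 1)
          = 2 * doppler ε k * S * (B.1 / A.1 - 1) ∧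
        (doppler ε k ^ 2 + 1) * S * (B.1 / A.1 / (doppler ε B.2 / doppler ε A.2) - 1)
          = 2 * doppler ε k * (B.1 / A.1 - 1)) := by
  have hEA := doppler_pos hε hA.2
  have hEB := doppler_pos hε hB.2
  have ha := hA.1
  have hb := hB.1
  rw [rankineHugoniot_iff hε hk hkε hr hr₀ (by positivity) hA hB]
  have hne : A.1 * doppler ε A.2 ≠ 0 := by positivity
  constructor
  · rintro ⟨h1, h2⟩
    constructor
    · field_simp
      linear_combination h1
    · field_simp
      field_simp at h2
      linear_combination h2
  · rintro ⟨h1, h2⟩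
    constructor
    · field_simp at h1
      linear_combination h1
    · field_simp
      field_simp at h2
      linear_combination h2

theorem compression_of_isShock₁ (hε : 0 < ε) (hk : 0 < k) (hkε : k < 1 / ε) (hr : 0 < r₀)
    (hr₀ : 2 * M < r₀) {s : ℝ} {A B : State} (hA : Admissible ε A) (hB : Admissible ε B)
    (h : IsShock₁ M ε k r₀ s A B) :
    s < velocity M ε r₀ (doppler ε B.2) ∧ 1 < B.1 / A.1 ∧ doppler ε B.2 / doppler ε A.2 < 1 ∧
      (doppler ε k ^ 2 + 1) ^ 2 * ((1 - doppler ε B.2 / doppler ε A.2) ^ 2 * (B.1 / A.1)) =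
        (doppler ε k ^ 2 - 1) ^ 2 * ((B.1 / A.1 - 1) ^ 2 * (doppler ε B.2 / doppler ε A.2)) := by
  have hη : 0 < 1 - 2 * M / r₀ := by rw [sub_pos, div_lt_one hr]; exact hr₀
  have hEA := doppler_pos hε hA.2
  have hEB := doppler_pos hε hB.2
  have ha := hA.1
  have hb := hB.1
  have hm := one_lt_doppler hε hk hkε
  have hm0 : 0 < doppler ε k := by linarith
  obtain ⟨hRH, hl, hr'⟩ := h
  rw [speed₁_eq hε hk hkε hA] at hl
  rw [speed₁_eq hε hk hkε hB] at hr'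
  have b1 := (velocity_bounds hε hη (div_pos hEB hm0)).1
  have b2 := (velocity_bounds hε hη (div_pos hEA hm0)).2
  -- The Lax inequalities enclose s between two subluminal speeds, so s has a positive Doppler
  -- factor of its own.
  have c1 : ε * velocity M ε r₀ (doppler ε B.2 / doppler ε k) < ε * s := by gcongr
  have c2 : ε * s < ε * velocity M ε r₀ (doppler ε A.2 / doppler ε k) := by gcongr
  have hSpos := speedFactor_pos (M := M) (ε := ε) (r₀ := r₀) (y := s) (by linarith) (by linarith)
  have hs := velocity_speedFactor hε hη (y := s) (by linarith)
  obtain ⟨S, hS⟩ : ∃ S, speedFactor M ε r₀ s = S * doppler ε A.2 :=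
    ⟨speedFactor M ε r₀ s / doppler ε A.2, by field_simp⟩
  rw [hS] at hs hSpos
  have hS0 : 0 < S := pos_of_mul_pos_left hSpos hEA.le
  rw [← hs] at hRH hl hr' ⊢
  rw [velocity_lt_iff hε hη hSpos (by positivity), lt_div_iff₀ hm0] at hl
  rw [velocity_lt_iff hε hη (by positivity) hSpos, div_lt_iff₀ hm0] at hr'
  rw [rankineHugoniot_iff_ratio hε hk hkε hr hr₀ hS0 hA hB] at hRH
  obtain ⟨d1, d2, d3, d4⟩ := shock_necessary hm (by positivity) (by positivity) hS0 hRH.1 hRH.2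
    (by
      have : doppler ε k * S * doppler ε A.2 < 1 * doppler ε A.2 := by linarith
      exact lt_of_mul_lt_mul_right this hEA.le)
    (by rw [div_lt_iff₀ hEA]; linarith)
  refine ⟨?_, d1, d2, d4⟩
  rw [velocity_lt_iff hε hη hSpos hEB]
  rwa [lt_div_iff₀ hEA] at d3

theorem exists_isShock₁_iff (hε : 0 < ε) (hk : 0 < k) (hkε : k < 1 / ε) (hr : 0 < r₀)
    (hr₀ : 2 * M < r₀) {A B : State} (hA : Admissible ε A) (hB : Admissible ε B) :
    (∃ s, IsShock₁ M ε k r₀ s A B) ↔ 0 < Real.log B.1 - Real.log A.1 ∧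
      Real.sinh (rapidity ε B - rapidity ε A) =
        -(2 * slope ε k * Real.sinh ((Real.log B.1 - Real.log A.1) / 2)) := by
  have hη : 0 < 1 - 2 * M / r₀ := by rw [sub_pos, div_lt_one hr]; exact hr₀
  have hEA := doppler_pos hε hA.2
  have hEB := doppler_pos hε hB.2
  have hm := one_lt_doppler hε hk hkε
  have hm0 : 0 < doppler ε k := by linarith
  rw [← hugoniot_iff hm (slope_eq hε hk hkε) (exp_rapidity_sub hε hA hB) (exp_log_sub hA.1 hB.1)]
  constructor
  · rintro ⟨s, hs⟩
    exact (compression_of_isShock₁ hε hk hkε hr hr₀ hA hB hs).2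
  · rintro ⟨h1, h2, h3⟩
    obtain ⟨S, hS, e1, e2, e3, e4⟩ := shock_sufficient hm h1 (by positivity) h2 h3
    refine ⟨velocity M ε r₀ (S * doppler ε A.2),
      (rankineHugoniot_iff_ratio hε hk hkε hr hr₀ hS hA hB).mpr ⟨e1, e2⟩, ?_, ?_⟩
    · rw [speed₁_eq hε hk hkε hA, velocity_lt_iff hε hη (by positivity) (by positivity),
        lt_div_iff₀ hm0]
      have : doppler ε k * S * doppler ε A.2 < 1 * doppler ε A.2 := by gcongr
      linarith
    · rw [speed₁_eq hε hk hkε hB, velocity_lt_iff hε hη (by positivity) (by positivity),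
        div_lt_iff₀ hm0]
      rw [div_lt_iff₀ hEA] at e4
      linarith

/-! ### Wave curves as graphs -/

/-- The loss of rapidity across a 1-wave as a function of the logarithm of the density ratio. -/
def waveFun (K ξ : ℝ) : ℝ :=
  if ξ ≤ 0 then K * ξ else Real.arsinh (2 * K * Real.sinh (ξ / 2))

theorem waveFun_zero (K : ℝ) : waveFun K 0 = 0 := by simp [waveFun]

theorem continuous_waveFun (K : ℝ) : Continuous (waveFun K) := by
  unfold waveFun
  refine Continuous.if_le (by fun_prop) ?_ continuous_id continuous_const ?_
  · exact Real.continuous_arsinh.comp (by fun_prop)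
  · rintro x rfl
    simp

theorem strictMono_waveFun {K : ℝ} (hK : 0 < K) : StrictMono (waveFun K) := by
  have hpos {x : ℝ} (hx : 0 < x) : 0 < Real.arsinh (2 * K * Real.sinh (x / 2)) :=
    Real.arsinh_pos_iff.mpr (mul_pos (by positivity) (Real.sinh_pos_iff.mpr (by positivity)))
  intro a b hab
  unfold waveFun
  split_ifs with h1 h2 h2
  · gcongr
  · have := hpos (not_le.mp h2)
    have := mul_nonneg hK.le (neg_nonneg.mpr h1)
    linarith
  · linarith
  · refine Real.arsinh_strictMono ?_
    have : Real.sinh (a / 2) < Real.sinh (b / 2) := Real.sinh_strictMono (by linarith)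
    gcongr

theorem tendsto_waveFun_atTop {K : ℝ} (hK : 0 < K) :
    Filter.Tendsto (waveFun K) Filter.atTop Filter.atTop := by
  refine ((strictMono_waveFun hK).monotone).tendsto_atTop_atTop fun b => ?_
  -- This is the preimage of `max b 1`; the maximum with 1 makes it positive, so that the shock
  -- branch applies.
  refine ⟨2 * Real.arsinh ((Real.sinh (max b 1)) / (2 * K)), ?_⟩
  have h1 : 0 < Real.sinh (max b 1) := Real.sinh_pos_iff.mpr (by positivity)
  have h2 : 0 < Real.arsinh ((Real.sinh (max b 1)) / (2 * K)) :=
    Real.arsinh_pos_iff.mpr (by positivity)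
  rw [waveFun, if_neg (by linarith), mul_div_cancel_left₀ _ two_ne_zero, Real.sinh_arsinh,
    mul_div_cancel₀ _ (by positivity), Real.arsinh_sinh]
  exact le_max_left _ _

theorem tendsto_waveFun_atBot {K : ℝ} (hK : 0 < K) :
    Filter.Tendsto (waveFun K) Filter.atBot Filter.atBot := by
  refine ((strictMono_waveFun hK).monotone).tendsto_atBot_atBot fun b => ?_
  refine ⟨min b 0 / K, ?_⟩
  rw [waveFun, if_pos (div_nonpos_of_nonpos_of_nonneg (min_le_right _ _) hK.le),
    mul_div_cancel₀ _ hK.ne']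
  exact min_le_left _ _

theorem state_ext (hε : 0 < ε) {A B : State} (hA : Admissible ε A) (hB : Admissible ε B)
    (h1 : Real.log A.1 = Real.log B.1) (h2 : rapidity ε A = rapidity ε B) : A = B := by
  have e1 : A.1 = B.1 := Real.log_injOn_pos hA.1 hB.1 h1
  have e2 : doppler ε A.2 = doppler ε B.2 :=
    Real.log_injOn_pos (doppler_pos hε hA.2) (doppler_pos hε hB.2) (by
      simp only [rapidity] at h2; linarith)
  refine Prod.ext e1 ?_
  rw [← undoppler_doppler hε hA.2, ← undoppler_doppler hε hB.2, e2]

theorem speed₁_lt_iff (hε : 0 < ε) (hk : 0 < k) (hkε : k < 1 / ε) (hη : 0 < 1 - 2 * M / r₀)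
    {A B : State} (hA : Admissible ε A) (hB : Admissible ε B) :
    speed₁ M ε k r₀ A < speed₁ M ε k r₀ B ↔ rapidity ε A < rapidity ε B := by
  have hEA := doppler_pos hε hA.2
  have hEB := doppler_pos hε hB.2
  have hm0 : 0 < doppler ε k := by linarith [one_lt_doppler hε hk hkε]
  rw [speed₁_eq hε hk hkε hA, speed₁_eq hε hk hkε hB,
    velocity_lt_iff hε hη (by positivity) (by positivity), div_lt_div_iff_of_pos_right hm0,
    rapidity, rapidity, mul_lt_mul_iff_right₀ (by norm_num), Real.log_lt_log_iff hEA hEB]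

/-- The sign of the jump of log density separates the cases: positive is a shock, zero the base
point, negative a rarefaction. On the rarefaction branch the speed increases with the rapidity,
hence as the density drops. -/
theorem mem_waveCurve₁_iff (hε : 0 < ε) (hk : 0 < k) (hkε : k < 1 / ε) (hr : 0 < r₀)
    (hr₀ : 2 * M < r₀) {A U : State} (hA : Admissible ε A) :
    U ∈ waveCurve₁ M ε k r₀ A ↔ Admissible ε U ∧
      rapidity ε U - rapidity ε A = -waveFun (slope ε k) (Real.log U.1 - Real.log A.1) := by
  have hη : 0 < 1 - 2 * M / r₀ := by rw [sub_pos, div_lt_one hr]; exact hr₀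
  have hK := slope_pos hε hk
  have hW {U : State} : invW ε k U = invW ε k A ↔
      rapidity ε U - rapidity ε A = -(slope ε k * (Real.log U.1 - Real.log A.1)) := by
    rw [invW_eq hε, invW_eq hε, div_left_inj' hε.ne']
    constructor <;> intro h <;> linarith
  constructor
  · rintro ((rfl | ⟨hU, hs⟩) | ⟨hU, hw, hl⟩)
    · exact ⟨hA, by simp [waveFun_zero]⟩
    · rw [exists_isShock₁_iff hε hk hkε hr hr₀ hA hU] at hs
      refine ⟨hU, ?_⟩
      rw [waveFun, if_neg (not_le.mpr hs.1), ← Real.arsinh_neg, ← hs.2, Real.arsinh_sinh]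
    · refine ⟨hU, ?_⟩
      rw [hW] at hw
      rw [speed₁_lt_iff hε hk hkε hη hA hU] at hl
      rw [waveFun, if_pos, hw]
      by_contra hc
      have := mul_pos hK (not_le.mp hc)
      linarith
  · rintro ⟨hU, h⟩
    rcases lt_trichotomy (Real.log U.1 - Real.log A.1) 0 with hξ | hξ | hξ
    · rw [waveFun, if_pos hξ.le] at h
      refine Or.inr ⟨hU, hW.mpr h, (speed₁_lt_iff hε hk hkε hη hA hU).mpr ?_⟩
      have := mul_pos hK (neg_pos.mpr hξ)
      linarith
    · rw [hξ, waveFun_zero] at h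
      exact Or.inl (Or.inl (state_ext hε hU hA (by linarith) (by linarith)))
    · refine Or.inl (Or.inr ⟨hU, (exists_isShock₁_iff hε hk hkε hr hr₀ hA hU).mpr ⟨hξ, ?_⟩⟩)
      rw [h, waveFun, if_neg (not_le.mpr hξ), Real.sinh_neg, Real.sinh_arsinh]

/-! ### Reflection of the velocity exchanges the two families -/

/-- Reflection of the velocity. -/
def reflect (U : State) : State := (U.1, -U.2)

theorem reflect_reflect (U : State) : reflect (reflect U) = U := by simp [reflect]

theorem admissible_reflect {U : State} : Admissible ε (reflect U) ↔ Admissible ε U := by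
  simp [Admissible, reflect]

theorem conserved_zero_reflect (U : State) :
    conserved M ε k r₀ (reflect U) 0 = conserved M ε k r₀ U 0 := by
  simp [conserved, reflect]

theorem flux_zero_reflect (U : State) :
    flux M ε k r₀ (reflect U) 0 = -flux M ε k r₀ U 0 := by
  simp [flux, reflect]

theorem conserved_one_reflect (U : State) :
    conserved M ε k r₀ (reflect U) 1 = -conserved M ε k r₀ U 1 := by
  simp [conserved, reflect]

theorem flux_one_reflect (U : State) :
    flux M ε k r₀ (reflect U) 1 = flux M ε k r₀ U 1 := by
  simp [flux, reflect]

theorem speed₂_eq (U : State) : speed₂ M ε k r₀ U = -speed₁ M ε k r₀ (reflect U) :=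
  speed₂_neg U

theorem invZ_eq (U : State) : invZ ε k U = -invW ε k (reflect U) := by
  have : (1 + ε * -U.2) / (1 - ε * -U.2) = ((1 + ε * U.2) / (1 - ε * U.2))⁻¹ := by
    rw [inv_div]; congr 1 <;> ring
  simp only [invZ, invW, reflect, this, Real.log_inv]
  ring

theorem rapidity_reflect (U : State) : rapidity ε (reflect U) = -rapidity ε U := by
  simp [rapidity, reflect, doppler_neg, Real.log_inv]

theorem rankineHugoniot_reflect {s : ℝ} {A B : State} :
    RankineHugoniot M ε k r₀ (-s) (reflect B) (reflect A) ↔ RankineHugoniot M ε k r₀ s A B := by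
  simp only [RankineHugoniot, Fin.forall_fin_two, conserved_zero_reflect, conserved_one_reflect,
    flux_zero_reflect, flux_one_reflect]
  constructor <;> rintro ⟨h1, h2⟩ <;> constructor <;> linarith

theorem isShock₁_reflect {s : ℝ} {A B : State} :
    IsShock₁ M ε k r₀ (-s) (reflect B) (reflect A) ↔ IsShock₂ M ε k r₀ s A B := by
  simp only [IsShock₁, IsShock₂, rankineHugoniot_reflect, speed₂_eq]
  constructor <;> rintro ⟨h1, h2, h3⟩ <;> refine ⟨h1, ?_, ?_⟩ <;> linarith

theorem reflect_mem_waveCurve₁ {B U : State} :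
    reflect U ∈ waveCurve₁ M ε k r₀ (reflect B) ↔ U ∈ waveCurve₂ M ε k r₀ B := by
  have h1 : reflect U = reflect B ↔ U = B :=
    ⟨fun h => by rw [← reflect_reflect U, h, reflect_reflect], fun h => by rw [h]⟩
  have h2 : (∃ s, IsShock₁ M ε k r₀ s (reflect B) (reflect U)) ↔
      ∃ s, IsShock₂ M ε k r₀ s U B := by
    simp only [← isShock₁_reflect]
    exact ⟨fun ⟨s, hs⟩ => ⟨-s, by rwa [neg_neg]⟩, fun ⟨s, hs⟩ => ⟨-s, hs⟩⟩
  simp only [waveCurve₁, waveCurve₂, shockCurve₁, shockCurve₂, rarefactionCurve₁,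
    rarefactionCurve₂, Set.mem_union, Set.mem_singleton_iff, Set.mem_ofPred_eq, h1, h2,
    admissible_reflect, invZ_eq, speed₂_eq, neg_inj, neg_lt_neg_iff]

theorem mem_waveCurve₂_iff (hε : 0 < ε) (hk : 0 < k) (hkε : k < 1 / ε) (hr : 0 < r₀)
    (hr₀ : 2 * M < r₀) {B U : State} (hB : Admissible ε B) :
    U ∈ waveCurve₂ M ε k r₀ B ↔ Admissible ε U ∧
      rapidity ε U - rapidity ε B = waveFun (slope ε k) (Real.log U.1 - Real.log B.1) := by
  rw [← reflect_mem_waveCurve₁, mem_waveCurve₁_iff hε hk hkε hr hr₀ (admissible_reflect.mpr hB),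
    admissible_reflect, rapidity_reflect, rapidity_reflect]
  simp only [reflect]
  refine and_congr_right fun _ => ?_
  constructor <;> intro h <;> linarith

/-! ### The middle state -/

/-- Subtracting the two graph equations eliminates the rapidity and leaves g(l) = const for the log
density l, with g continuous, strictly increasing and onto. The rapidity is then read off from
either graph. -/
theorem exists_inter_waveCurves (hε : 0 < ε) (hk : 0 < k) (hkε : k < 1 / ε) (hr : 0 < r₀)
    (hr₀ : 2 * M < r₀) {A B : State} (hA : Admissible ε A) (hB : Admissible ε B) :
    ∃ U, Admissible ε U ∧ waveCurve₁ M ε k r₀ A ∩ waveCurve₂ M ε k r₀ B = {U} := by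
  have hK := slope_pos hε hk
  set f := waveFun (slope ε k) with hf
  let g : ℝ → ℝ := fun l => f (l - Real.log A.1) + f (l - Real.log B.1)
  have hg : StrictMono g := fun a b hab =>
    add_lt_add (strictMono_waveFun hK (by linarith)) (strictMono_waveFun hK (by linarith))
  have hgs : Function.Surjective g := by
    have hc := continuous_waveFun (slope ε k)
    refine Continuous.surjective (by fun_prop) ?_ ?_
    · exact Filter.Tendsto.atTop_add_atTop
        ((tendsto_waveFun_atTop hK).comp (Filter.tendsto_atTop_add_const_right _ _ Filter.tendsto_id))
        ((tendsto_waveFun_atTop hK).comp (Filter.tendsto_atTop_add_const_right _ _ Filter.tendsto_id))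
    · exact Filter.Tendsto.atBot_add_atBot
        ((tendsto_waveFun_atBot hK).comp (Filter.tendsto_atBot_add_const_right _ _ Filter.tendsto_id))
        ((tendsto_waveFun_atBot hK).comp (Filter.tendsto_atBot_add_const_right _ _ Filter.tendsto_id))
  obtain ⟨l, hl⟩ := hgs (rapidity ε A - rapidity ε B)
  have hE := Real.exp_pos (2 * (rapidity ε A - f (l - Real.log A.1)))
  let U : State := (Real.exp l, undoppler ε (Real.exp (2 * (rapidity ε A - f (l - Real.log A.1)))))
  have hU : Admissible ε U := ⟨Real.exp_pos _, abs_undoppler_lt hε hE⟩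
  have hUl : Real.log U.1 = l := Real.log_exp l
  have hUr : rapidity ε U = rapidity ε A - f (l - Real.log A.1) := by
    change 1 / 2 * Real.log (doppler ε (undoppler ε _)) = _
    rw [doppler_undoppler hε hE, Real.log_exp]
    ring
  refine ⟨U, hU, Set.eq_singleton_iff_unique_mem.mpr ⟨?_, ?_⟩⟩
  · rw [Set.mem_inter_iff, mem_waveCurve₁_iff hε hk hkε hr hr₀ hA,
      mem_waveCurve₂_iff hε hk hkε hr hr₀ hB, hUl, hUr]
    simp only [g] at hl
    exact ⟨⟨hU, by ring⟩, hU, by rw [← hf]; linarith⟩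
  · intro W hW
    rw [Set.mem_inter_iff, mem_waveCurve₁_iff hε hk hkε hr hr₀ hA,
      mem_waveCurve₂_iff hε hk hkε hr hr₀ hB, ← hf] at hW
    obtain ⟨⟨hW, h1⟩, -, h2⟩ := hW
    have : g (Real.log W.1) = g l := by rw [hl]; simp only [g]; linarith
    have hWl : Real.log W.1 = l := hg.injective this
    refine state_ext hε hW hU (by rw [hWl, hUl]) ?_
    rw [hUr]
    rw [hWl] at h1
    linarith

/-! ### Weak formulation for self-similar functions -/

section SelfSimilar

open MeasureTheory

theorem exists_support_bound {φ : ℝ × ℝ → ℝ} (hc : HasCompactSupport φ) :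
    ∃ B, 0 < B ∧ ∀ p : ℝ × ℝ, B < |p.1| ∨ B < |p.2| → φ p = 0 ∧ fderiv ℝ φ p = 0 := by
  obtain ⟨B, hB⟩ := hc.isCompact.isBounded.subset_closedBall 0
  refine ⟨max B 1, by positivity, fun p hp => ?_⟩
  have hp' : p ∉ tsupport φ := by
    intro h
    have := hB h
    rw [Metric.mem_closedBall, dist_zero_right, Prod.norm_def, max_le_iff, Real.norm_eq_abs,
      Real.norm_eq_abs] at this
    have := le_max_left B 1
    rcases hp with hp | hp <;> linarith
  exact ⟨image_eq_zero_of_notMem_tsupport hp',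
    Function.notMem_support.mp fun h => hp' (support_fderiv_subset ℝ h)⟩

theorem integral_similarity {t : ℝ} (ht : 0 < t) (r₀ : ℝ) (F : ℝ → ℝ) :
    ∫ r, F r = ∫ y, t * F (r₀ + t * y) := by
  have h1 := Measure.integral_comp_mul_left (fun x => F (r₀ + x)) t
  rw [integral_const_mul, h1, abs_of_pos (inv_pos.mpr ht), smul_eq_mul,
    integral_add_left_eq_self (μ := volume) F r₀]
  field_simp

theorem integrable_mul_of_bounded {α : Type*} [MeasurableSpace α] {μ : Measure α} {h ψ : α → ℝ}
    {C : ℝ} (hm : Measurable h) (hb : ∀ y, |h y| ≤ C) (hψ : Integrable ψ μ) :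
    Integrable (fun y => h y * ψ y) μ :=
  hψ.bdd_mul hm.aestronglyMeasurable (Filter.Eventually.of_forall hb)

theorem integral_eq_zero_of_compact_primitive {G G' : ℝ → ℝ} {s : Set ℝ} (hs : s.Countable)
    (hG : Continuous G) (hd : ∀ y ∉ s, HasDerivAt G (G' y) y) (hi : Integrable G') {Y : ℝ}
    (hY : 0 ≤ Y) (hz : ∀ y, Y < |y| → G y = 0 ∧ G' y = 0) : ∫ y, G' y = 0 := by
  have h := integral_eq_of_hasDerivAt_off_countable G G' (a := -(Y + 1)) (b := Y + 1) hs
    hG.continuousOn (fun y hy => hd y hy.2) hi.intervalIntegrable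
  rw [(hz (Y + 1) (by rw [abs_of_pos] <;> linarith)).1,
    (hz (-(Y + 1)) (by rw [abs_neg, abs_of_pos] <;> linarith)).1, sub_zero,
    intervalIntegral.integral_eq_integral_of_support_subset] at h
  · exact h
  · intro y hy
    by_contra hc
    refine hy (hz y ?_).2
    rw [Set.mem_Ioc, not_and_or, not_lt, not_le] at hc
    rcases hc with hc | hc
    · exact lt_of_lt_of_le (by linarith) (neg_le_abs y)
    · exact lt_of_lt_of_le (by linarith) (le_abs_self y)

variable {h f : ℝ → ℝ} {C : ℝ} {s : Set ℝ} {φ : ℝ × ℝ → ℝ}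

theorem hasDerivAt_similarity (hφ : ContDiff ℝ ∞ φ) (r₀ y t : ℝ) :
    HasDerivAt (fun t => φ (t, r₀ + t * y))
      (fderiv ℝ φ (t, r₀ + t * y) (1, 0) + y * fderiv ℝ φ (t, r₀ + t * y) (0, 1)) t := by
  have h1 : HasDerivAt (fun t : ℝ => (t, r₀ + t * y)) (1, y) t := by
    refine (hasDerivAt_id t).prodMk ?_
    simpa using ((hasDerivAt_id t).mul_const y).const_add r₀
  have h2 := (hφ.differentiable (by simp) (t, r₀ + t * y)).hasFDerivAt.comp_hasDerivAt t h1
  refine h2.congr_deriv ?_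
  rw [show ((1 : ℝ), y) = (1, 0) + y • ((0 : ℝ), (1 : ℝ)) by simp, map_add, map_smul, smul_eq_mul]

theorem hasDerivAt_similarity_right (hφ : ContDiff ℝ ∞ φ) (r₀ y t : ℝ) :
    HasDerivAt (fun y => φ (t, r₀ + t * y)) (t * fderiv ℝ φ (t, r₀ + t * y) (0, 1)) y := by
  have h1 : HasDerivAt (fun y : ℝ => (t, r₀ + t * y)) (0, t) y := by
    refine (hasDerivAt_const y t).prodMk ?_
    simpa using ((hasDerivAt_id y).const_mul t).const_add r₀
  have h2 := (hφ.differentiable (by simp) (t, r₀ + t * y)).hasFDerivAt.comp_hasDerivAt y h1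
  refine h2.congr_deriv ?_
  rw [show ((0 : ℝ), t) = t • ((0 : ℝ), (1 : ℝ)) by simp, map_smul, smul_eq_mul]

/-- The rate of change of the total amount of a self-similar density against a test function. -/
theorem hasDerivAt_integral_similarity (hm : Measurable h) (hb : ∀ y, |h y| ≤ C)
    (hg : Continuous fun y => f y - y * h y)
    (hs : s.Countable) (hd : ∀ y ∉ s, HasDerivAt (fun y => f y - y * h y) (-h y) y)
    (hφ : ContDiff ℝ ∞ φ) (hc : HasCompactSupport φ) (r₀ : ℝ) {t : ℝ} (ht : 0 < t) :
    HasDerivAt (fun t => ∫ r, h ((r - r₀) / t) * φ (t, r))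
      (∫ r, (h ((r - r₀) / t) * fderiv ℝ φ (t, r) (1, 0)
        + f ((r - r₀) / t) * fderiv ℝ φ (t, r) (0, 1))) t := by
  obtain ⟨B, hB0, hB⟩ := exists_support_bound hc
  have hC : 0 ≤ C := (abs_nonneg _).trans (hb 0)
  have cφ : Continuous φ := hφ.continuous
  have cd (v : ℝ × ℝ) : Continuous fun p => fderiv ℝ φ p v :=
    (hφ.continuous_fderiv (by simp)).clm_apply continuous_const
  have c1 := cd (1, 0)
  have c2 := cd (0, 1)
  obtain ⟨D₀, hD₀⟩ := hc.exists_bound_of_continuous cφ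
  obtain ⟨D₁, hD₁⟩ := (hc.fderiv_apply (𝕜 := ℝ) (1, 0)).exists_bound_of_continuous c1
  obtain ⟨D₂, hD₂⟩ := (hc.fderiv_apply (𝕜 := ℝ) (0, 1)).exists_bound_of_continuous c2
  have hD₀' : 0 ≤ D₀ := (norm_nonneg _).trans (hD₀ 0)
  have hD₁' : 0 ≤ D₁ := (norm_nonneg _).trans (hD₁ 0)
  have hD₂' : 0 ≤ D₂ := (norm_nonneg _).trans (hD₂ 0)
  -- For τ > t/2 and |y| > Y the point (τ, r₀ + τy) lies outside the support of φ, so all integrands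
  -- below live on one compact interval.
  set Y := 2 * (B + |r₀|) / t with hY
  have hY0 : 0 ≤ Y := by positivity
  have hfar {τ y : ℝ} (hτ : t / 2 < τ) (hy : Y < |y|) : B < |r₀ + τ * y| := by
    have h1 : τ * |y| ≤ |r₀ + τ * y| + |r₀| := by
      have := abs_sub (r₀ + τ * y) r₀
      rw [add_sub_cancel_left, abs_mul, abs_of_pos (by linarith)] at this
      exact this
    have h2 : t / 2 * Y < τ * |y| := by
      have : 0 < τ := by linarith
      calc t / 2 * Y ≤ τ * Y := by gcongr
        _ < τ * |y| := by gcongr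
    have h3 : t / 2 * Y = B + |r₀| := by rw [hY]; field_simp
    linarith
  have hfar0 {τ y : ℝ} (hτ : t / 2 < τ) (hy : Y < |y|) :=
    hB (τ, r₀ + τ * y) (Or.inr (hfar hτ hy))
  have hcs {ψ : ℝ → ℝ} (hψ : ∀ y, Y < |y| → ψ y = 0) (hcψ : Continuous ψ) : Integrable ψ := by
    refine hcψ.integrable_of_hasCompactSupport
      (HasCompactSupport.intro (isCompact_Icc (a := -Y) (b := Y)) fun y hy => hψ y ?_)
    by_contra hc
    exact hy (abs_le.mp (not_lt.mp hc))
  -- differentiation under the integral sign in the similarity variable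
  have key := hasDerivAt_integral_of_dominated_loc_of_deriv_le (μ := volume)
    (F := fun τ y => h y * (τ * φ (τ, r₀ + τ * y)))
    (F' := fun τ y => h y * (φ (τ, r₀ + τ * y) + τ * (fderiv ℝ φ (τ, r₀ + τ * y) (1, 0)
      + y * fderiv ℝ φ (τ, r₀ + τ * y) (0, 1))))
    (s := Set.Ioo (t / 2) (2 * t)) (x₀ := t)
    (bound := (Set.Icc (-Y) Y).indicator fun _ => C * (D₀ + 2 * t * (D₁ + Y * D₂)))
    (Ioo_mem_nhds (by linarith) (by linarith))
    (Filter.Eventually.of_forall fun τ =>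
      (hm.mul (Continuous.measurable (by fun_prop))).aestronglyMeasurable)
    (integrable_mul_of_bounded hm hb (hcs (fun y hy => by
      rw [(hfar0 (by linarith) hy).1, mul_zero]) (by fun_prop)))
    ((hm.mul (Continuous.measurable (by fun_prop))).aestronglyMeasurable)
    (Filter.Eventually.of_forall fun y τ hτ => by
      by_cases hy : Y < |y|
      · obtain ⟨e1, e2⟩ := hfar0 hτ.1 hy
        rw [e1, e2]
        simp only [zero_apply, mul_zero, add_zero, norm_zero]
        exact Set.indicator_nonneg (fun _ _ => by positivity) _
      · push Not at hy
        rw [Set.indicator_of_mem (show y ∈ Set.Icc (-Y) Y from abs_le.mp hy), norm_mul]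
        have hτ0 : 0 < τ := by linarith [hτ.1]
        have e1 := hD₀ (τ, r₀ + τ * y)
        have e2 := hD₁ (τ, r₀ + τ * y)
        have e3 := hD₂ (τ, r₀ + τ * y)
        have e4 : ‖y * fderiv ℝ φ (τ, r₀ + τ * y) (0, 1)‖ ≤ Y * D₂ := by
          rw [norm_mul]; exact mul_le_mul hy e3 (norm_nonneg _) hY0
        have e5 : ‖τ * (fderiv ℝ φ (τ, r₀ + τ * y) (1, 0)
            + y * fderiv ℝ φ (τ, r₀ + τ * y) (0, 1))‖ ≤ 2 * t * (D₁ + Y * D₂) := by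
          rw [norm_mul, Real.norm_of_nonneg hτ0.le]
          exact mul_le_mul hτ.2.le ((norm_add_le _ _).trans (add_le_add e2 e4)) (norm_nonneg _)
            (by positivity)
        exact mul_le_mul (hb y) ((norm_add_le _ _).trans (add_le_add e1 e5)) (norm_nonneg _) hC)
    (continuous_const.integrableOn_Icc.integrable_indicator measurableSet_Icc)
    (Filter.Eventually.of_forall fun y τ _ => by
      have := ((hasDerivAt_id τ).mul (hasDerivAt_similarity hφ r₀ y τ)).const_mul (h y)
      simpa using this)
  -- integration by parts
  set g : ℝ → ℝ := fun y => f y - y * h y with hgdef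
  have hi1 : Integrable fun y => h y * φ (t, r₀ + t * y) :=
    integrable_mul_of_bounded hm hb (hcs (fun y hy => (hfar0 (by linarith) hy).1) (by fun_prop))
  have hi2 : Integrable fun y => g y * (t * fderiv ℝ φ (t, r₀ + t * y) (0, 1)) :=
    hcs (fun y hy => by rw [(hfar0 (by linarith) hy).2]; simp) (by fun_prop)
  -- This is the integral of (gφ)'. It trades the term with g for the term hφ that appears when the
  -- Jacobian factor τ is differentiated.
  have parts : ∫ y, (-(h y * φ (t, r₀ + t * y)) +
      g y * (t * fderiv ℝ φ (t, r₀ + t * y) (0, 1))) = 0 := by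
    refine integral_eq_zero_of_compact_primitive (G := fun y => g y * φ (t, r₀ + t * y)) hs
      (by fun_prop) (fun y hy => ?_) (hi1.neg.add hi2) hY0 fun y hy => ?_
    · refine ((hd y hy).mul (hasDerivAt_similarity_right hφ r₀ y t)).congr_deriv ?_
      ring
    · obtain ⟨e1, e2⟩ := hfar0 (show t / 2 < t by linarith) hy
      simp [e1, e2]
  have val : ∫ r, (h ((r - r₀) / t) * fderiv ℝ φ (t, r) (1, 0)
        + f ((r - r₀) / t) * fderiv ℝ φ (t, r) (0, 1)) =
      ∫ y, h y * (φ (t, r₀ + t * y) + t * (fderiv ℝ φ (t, r₀ + t * y) (1, 0)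
      + y * fderiv ℝ φ (t, r₀ + t * y) (0, 1))) := by
    have hadd := integral_add key.1 (hi1.neg.add hi2)
    simp only [Pi.add_apply, Pi.neg_apply] at hadd
    rw [parts, add_zero] at hadd
    rw [integral_similarity ht r₀, ← hadd]
    refine integral_congr_ae (Filter.Eventually.of_forall fun y => ?_)
    simp only [add_sub_cancel_left, mul_div_cancel_left₀ _ ht.ne', hgdef]
    ring
  rw [val]
  refine key.2.congr_of_eventuallyEq ?_
  filter_upwards [lt_mem_nhds ht] with τ hτ
  rw [integral_similarity hτ r₀]
  refine integral_congr_ae (Filter.Eventually.of_forall fun y => ?_)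
  simp only [add_sub_cancel_left, mul_div_cancel_left₀ _ hτ.ne']
  ring

/-- For fixed r ≠ r₀, the similarity variable leaves [-R, R] as t decreases to 0, so the integrand
is eventually the Riemann datum times φ; dominated convergence does the rest. -/
theorem tendsto_integral_similarity (hm : Measurable h) (hb : ∀ y, |h y| ≤ C) {R hL hR : ℝ}
    (hl : ∀ y < -R, h y = hL) (hr : ∀ y > R, h y = hR) (hφ : ContDiff ℝ ∞ φ)
    (hc : HasCompactSupport φ) (r₀ : ℝ) :
    Filter.Tendsto (fun t => ∫ r, h ((r - r₀) / t) * φ (t, r)) (𝓝[>] 0)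
      (𝓝 (∫ r, (if r < r₀ then hL else hR) * φ (0, r))) := by
  obtain ⟨B, hB0, hB⟩ := exists_support_bound hc
  have hC : 0 ≤ C := (abs_nonneg _).trans (hb 0)
  have cφ : Continuous φ := hφ.continuous
  obtain ⟨D, hD⟩ := hc.exists_bound_of_continuous cφ
  have hD' : 0 ≤ D := (norm_nonneg _).trans (hD 0)
  refine tendsto_integral_filter_of_dominated_convergence
    ((Set.Icc (-B) B).indicator fun _ => C * D) ?_ ?_
    (continuous_const.integrableOn_Icc.integrable_indicator measurableSet_Icc) ?_
  · exact Filter.Eventually.of_forall fun t => ((hm.comp (by fun_prop)).mul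
      (Continuous.measurable (by fun_prop))).aestronglyMeasurable
  · refine Filter.Eventually.of_forall fun t => Filter.Eventually.of_forall fun r => ?_
    by_cases hy : B < |r|
    · rw [(hB (t, r) (Or.inr hy)).1, mul_zero, norm_zero]
      exact Set.indicator_nonneg (fun _ _ => by positivity) _
    · rw [Set.indicator_of_mem (show r ∈ Set.Icc (-B) B from abs_le.mp (not_lt.mp hy)), norm_mul]
      exact mul_le_mul (hb _) (hD _) (norm_nonneg _) hC
  · have hne : ∀ᵐ r : ℝ, r ≠ r₀ := by simp [ae_iff]
    filter_upwards [hne] with r hr'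
    refine Filter.Tendsto.mul ?_ ?_
    · have hR0 : 0 < max R 1 := by positivity
      have hRR := le_max_left R 1
      refine tendsto_const_nhds.congr' ?_
      have hpos : 0 < |r - r₀| / max R 1 := div_pos (abs_pos.mpr (sub_ne_zero.mpr hr')) hR0
      filter_upwards [Ioo_mem_nhdsGT hpos] with t ht
      have h1 : max R 1 < |r - r₀| / t := by
        rw [lt_div_iff₀ ht.1]
        have := (lt_div_iff₀ hR0).mp ht.2
        linarith
      rcases lt_or_gt_of_ne hr' with hlt | hgt
      · rw [if_pos hlt, hl]
        rw [abs_of_neg (by linarith), neg_div] at h1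
        linarith
      · rw [if_neg (by linarith), hr]
        rw [abs_of_pos (by linarith)] at h1
        linarith
    · exact ((cφ.comp (by fun_prop : Continuous fun t : ℝ => (t, r))).tendsto 0).mono_left
        nhdsWithin_le_nhds

/-- A self-similar pair `(h, f)` whose combination `f - y h` is continuous with derivative `-h`
outside a countable set satisfies the conservation law weakly, with Riemann initial data. -/
theorem weak_of_selfSimilar (hm : Measurable h) (fm : Measurable f)
    (hb : ∀ y, |h y| ≤ C) (fb : ∀ y, |f y| ≤ C) (hg : Continuous fun y => f y - y * h y)
    (hs : s.Countable) (hd : ∀ y ∉ s, HasDerivAt (fun y => f y - y * h y) (-h y) y)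
    {R hL hR : ℝ} (hl : ∀ y < -R, h y = hL) (hr : ∀ y > R, h y = hR)
    (hφ : ContDiff ℝ ∞ φ) (hc : HasCompactSupport φ) (r₀ : ℝ) :
    (∫ p in Set.Ioi (0 : ℝ) ×ˢ (Set.univ : Set ℝ), (h ((p.2 - r₀) / p.1) * fderiv ℝ φ p (1, 0)
        + f ((p.2 - r₀) / p.1) * fderiv ℝ φ p (0, 1)))
      + ∫ r, (if r < r₀ then hL else hR) * φ (0, r) = 0 := by
  obtain ⟨B, hB0, hB⟩ := exists_support_bound hc
  have cd (v : ℝ × ℝ) : Continuous fun p => fderiv ℝ φ p v :=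
    (hφ.continuous_fderiv (by simp)).clm_apply continuous_const
  have hint : Integrable fun p : ℝ × ℝ => h ((p.2 - r₀) / p.1) * fderiv ℝ φ p (1, 0)
        + f ((p.2 - r₀) / p.1) * fderiv ℝ φ p (0, 1) :=
    (integrable_mul_of_bounded (hm.comp (by fun_prop)) (fun p => hb _)
      ((cd (1, 0)).integrable_of_hasCompactSupport (hc.fderiv_apply (𝕜 := ℝ) (1, 0)))).add
    (integrable_mul_of_bounded (fm.comp (by fun_prop)) (fun p => fb _)
      ((cd (0, 1)).integrable_of_hasCompactSupport (hc.fderiv_apply (𝕜 := ℝ) (0, 1))))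
  rw [Measure.volume_eq_prod] at hint ⊢
  rw [setIntegral_prod _ hint.integrableOn]
  simp only [Measure.restrict_univ]
  set I : ℝ → ℝ := fun t => ∫ r, h ((r - r₀) / t) * φ (t, r) with hI
  set I₀ := ∫ r, (if r < r₀ then hL else hR) * φ (0, r) with hI₀
  -- Division by zero makes `I 0` equal to h(0) times the integral of φ(0, ·), not the initial
  -- total. The update inserts the correct limit.
  have hup : ∀ t ≠ 0, Function.update I 0 I₀ t = I t := fun t ht => Function.update_of_ne ht _ _
  have := integral_Ioi_of_hasDerivAt_of_tendsto (a := 0) (m := 0)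
    (f := Function.update I 0 I₀)
    (f' := fun t => ∫ r, (h ((r - r₀) / t) * fderiv ℝ φ (t, r) (1, 0)
        + f ((r - r₀) / t) * fderiv ℝ φ (t, r) (0, 1))) ?_ ?_ ?_ ?_
  · rw [this, Function.update_self]; ring
  · rw [continuousWithinAt_update_same]
    have : Set.Ici (0 : ℝ) \ {0} = Set.Ioi 0 := by ext x; simp [lt_iff_le_and_ne, eq_comm]
    rw [this]
    exact tendsto_integral_similarity hm hb hl hr hφ hc r₀
  · intro t ht
    refine (hasDerivAt_integral_similarity hm hb hg hs hd hφ hc r₀ ht).congr_of_eventuallyEq ?_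
    filter_upwards [lt_mem_nhds ht] with τ hτ
    exact hup τ (ne_of_gt hτ)
  · exact hint.integral_prod_left.integrableOn
  · refine tendsto_const_nhds.congr' ?_
    filter_upwards [Filter.eventually_gt_atTop B] with t ht
    rw [hup t (by linarith)]
    simp only [hI]
    rw [integral_eq_zero_of_ae]
    refine Filter.Eventually.of_forall fun r => ?_
    simp [(hB (t, r) (Or.inl (lt_of_lt_of_le ht (le_abs_self t)))).1]

end SelfSimilar

/-! ### Self-similar solutions: reflection, gluing, shocks -/

/-- The profile `V` solves the system in the similarity variable: `F(V) - y H(V)` is continuous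
with derivative `-H(V)` outside `s`, and all discontinuities of `V` are Lax shocks. -/
structure IsSelfSimilarSolution (M ε k r₀ : ℝ) (V : ℝ → State) (s : Set ℝ) : Prop where
  admissible : ∀ y, Admissible ε (V y)
  measurable : Measurable V
  bounded : ∃ C, ∀ y i, |conserved M ε k r₀ (V y) i| ≤ C ∧ |flux M ε k r₀ (V y) i| ≤ C
  entropy : ∀ y, ContinuousAt V y ∨ ∃ A B, Admissible ε A ∧ Admissible ε B ∧
    Filter.Tendsto V (𝓝[<] y) (𝓝 A) ∧ Filter.Tendsto V (𝓝[>] y) (𝓝 B) ∧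
    (IsShock₁ M ε k r₀ y A B ∨ IsShock₂ M ε k r₀ y A B)
  continuousAt : ∀ i y,
    ContinuousAt (fun y => flux M ε k r₀ (V y) i - y * conserved M ε k r₀ (V y) i) y
  hasDerivAt : ∀ i, ∀ y ∉ s,
    HasDerivAt (fun y => flux M ε k r₀ (V y) i - y * conserved M ε k r₀ (V y) i)
      (-conserved M ε k r₀ (V y) i) y

theorem measurable_conserved (i : Fin 2) : Measurable fun U => conserved M ε k r₀ U i := by
  fin_cases i <;> simp [conserved] <;> fun_prop

theorem measurable_flux (i : Fin 2) : Measurable fun U => flux M ε k r₀ U i := by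
  fin_cases i <;> simp [flux] <;> fun_prop

theorem one_sub_sq_pos (hε : 0 < ε) {U : State} (hU : Admissible ε U) :
    0 < 1 - ε ^ 2 * U.2 ^ 2 := by
  obtain ⟨h1, h2⟩ := abs_mul_lt_one hε hU.2
  nlinarith

theorem continuousAt_conserved (hε : 0 < ε) {U : State} (hU : Admissible ε U) (i : Fin 2) :
    ContinuousAt (fun U => conserved M ε k r₀ U i) U := by
  have := (one_sub_sq_pos hε hU).ne'
  fin_cases i <;> simp only [conserved, Fin.zero_eta, Fin.mk_one, Matrix.cons_val_zero,
    Matrix.cons_val_one, Matrix.cons_val_fin_one] <;> fun_prop (disch := assumption)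

theorem continuousAt_flux (hε : 0 < ε) {U : State} (hU : Admissible ε U) (i : Fin 2) :
    ContinuousAt (fun U => flux M ε k r₀ U i) U := by
  have := (one_sub_sq_pos hε hU).ne'
  fin_cases i <;> simp only [flux, Fin.zero_eta, Fin.mk_one, Matrix.cons_val_zero,
    Matrix.cons_val_one, Matrix.cons_val_fin_one] <;> fun_prop (disch := assumption)

theorem IsSelfSimilarSolution.isEntropyWeakSolution {V : ℝ → State} {s : Set ℝ}
    (h : IsSelfSimilarSolution M ε k r₀ V s) (hs : s.Countable) {UL UR : State} {R : ℝ}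
    (hl : ∀ y < -R, V y = UL) (hr : ∀ y > R, V y = UR) :
    IsEntropyWeakSolution M ε k r₀ (riemannData r₀ UL UR) (fun t r => V ((r - r₀) / t)) where
  admissible t _ r := h.admissible _
  measurable := h.measurable.comp (by fun_prop)
  bounded := by
    obtain ⟨C, hC⟩ := h.bounded
    exact ⟨C, fun t _ r i => hC _ i⟩
  weak φ hφ hc i := by
    obtain ⟨C, hC⟩ := h.bounded
    have := weak_of_selfSimilar (h := fun y => conserved M ε k r₀ (V y) i)
      (f := fun y => flux M ε k r₀ (V y) i) (hL := conserved M ε k r₀ UL i)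
      (hR := conserved M ε k r₀ UR i) (R := R)
      ((measurable_conserved i).comp h.measurable) ((measurable_flux i).comp h.measurable)
      (fun y => (hC y i).1) (fun y => (hC y i).2)
      (continuous_iff_continuousAt.mpr (h.continuousAt i)) hs (h.hasDerivAt i)
      (fun y hy => by rw [hl y hy]) (fun y hy => by rw [hr y hy]) hφ hc r₀
    simp only [riemannData, apply_ite (fun U => conserved M ε k r₀ U i)]
    exact this
  entropy t ht r := by
    have hq : ContinuousAt (fun p : ℝ × ℝ => (p.2 - r₀) / p.1) (t, r) :=
      ContinuousAt.div (by fun_prop) (by fun_prop) ht.ne'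
    have hpos : ∀ᶠ p : ℝ × ℝ in 𝓝 (t, r), 0 < p.1 :=
      continuous_fst.continuousAt.eventually (lt_mem_nhds ht)
    rcases h.entropy ((r - r₀) / t) with hc | ⟨A, B, hA, hB, hl, hr, hsh⟩
    · exact Or.inl (ContinuousAt.comp (f := fun p : ℝ × ℝ => (p.2 - r₀) / p.1) hc hq)
    · refine Or.inr ⟨fun τ => r₀ + (r - r₀) / t * τ, (r - r₀) / t, A, B, ?_, ?_, hA, hB,
        hl.comp ?_, hr.comp ?_, hsh⟩
      · field_simp; ring
      · simpa using ((hasDerivAt_id t).const_mul ((r - r₀) / t)).const_add r₀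
      · refine tendsto_nhdsWithin_iff.mpr ⟨hq.tendsto.mono_left nhdsWithin_le_nhds, ?_⟩
        filter_upwards [self_mem_nhdsWithin, nhdsWithin_le_nhds hpos] with p hp h0
        rw [Set.mem_Iio, div_lt_iff₀ h0]
        have : p.2 < r₀ + (r - r₀) / t * p.1 := hp
        linarith
      · refine tendsto_nhdsWithin_iff.mpr ⟨hq.tendsto.mono_left nhdsWithin_le_nhds, ?_⟩
        filter_upwards [self_mem_nhdsWithin, nhdsWithin_le_nhds hpos] with p hp h0
        rw [Set.mem_Ioi, lt_div_iff₀ h0]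
        have : r₀ + (r - r₀) / t * p.1 < p.2 := hp
        linarith

theorem IsSelfSimilarSolution.reflect {V : ℝ → State} {s : Set ℝ}
    (h : IsSelfSimilarSolution M ε k r₀ V s) :
    IsSelfSimilarSolution M ε k r₀ (fun y => reflect (V (-y))) (Neg.neg ⁻¹' s) := by
  have cr : Continuous SchwarzschildFluid.reflect := by unfold SchwarzschildFluid.reflect; fun_prop
  -- Under reflection each conserved component and its flux have opposite parity, which compensates
  -- the sign change of y.
  have hsgn (i : Fin 2) : ∃ c : ℝ, |c| = 1 ∧ ∀ U,
      conserved M ε k r₀ (SchwarzschildFluid.reflect U) i = c * conserved M ε k r₀ U i ∧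
      flux M ε k r₀ (SchwarzschildFluid.reflect U) i = -c * flux M ε k r₀ U i := by
    fin_cases i
    · exact ⟨1, by simp, fun U => ⟨by simpa using conserved_zero_reflect U,
        by simpa using flux_zero_reflect U⟩⟩
    · exact ⟨-1, by simp, fun U => ⟨by simpa using conserved_one_reflect U,
        by simpa using flux_one_reflect U⟩⟩
  refine ⟨fun y => admissible_reflect.mpr (h.admissible _), cr.measurable.comp
    (h.measurable.comp measurable_neg), ?_, fun y => ?_, fun i y => ?_, fun i y hy => ?_⟩
  · obtain ⟨C, hC⟩ := h.bounded
    refine ⟨C, fun y i => ?_⟩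
    obtain ⟨c, hc, e⟩ := hsgn i
    rw [(e _).1, (e _).2, abs_mul, abs_mul, abs_neg, hc, one_mul, one_mul]
    exact hC _ i
  · rcases h.entropy (-y) with hc | ⟨A, B, hA, hB, hl, hr, hsh⟩
    · exact Or.inl (cr.continuousAt.comp (hc.comp (f := fun y => -y) continuous_neg.continuousAt))
    · refine Or.inr ⟨SchwarzschildFluid.reflect B, SchwarzschildFluid.reflect A,
        admissible_reflect.mpr hB, admissible_reflect.mpr hA,
        (cr.tendsto B).comp (hr.comp ?_), (cr.tendsto A).comp (hl.comp ?_), ?_⟩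
      · exact tendsto_neg_nhdsLT
      · exact tendsto_neg_nhdsGT
      · rcases hsh with hsh | hsh
        · refine Or.inr (isShock₁_reflect.mp ?_)
          rwa [reflect_reflect, reflect_reflect]
        · refine Or.inl ?_
          simpa using isShock₁_reflect.mpr hsh
  · obtain ⟨c, hc, e⟩ := hsgn i
    have := ((h.continuousAt i (-y)).comp (f := fun y => -y) continuous_neg.continuousAt).const_mul (-c)
    refine this.congr (Filter.Eventually.of_forall fun x => ?_)
    simp only [(e _).1, (e _).2, Function.comp]
    ring
  · obtain ⟨c, hc, e⟩ := hsgn i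
    have := ((h.hasDerivAt i (-y) hy).comp y (hasDerivAt_neg y)).const_mul (-c)
    refine (this.congr_deriv ?_).congr_of_eventuallyEq (Filter.Eventually.of_forall fun x => ?_)
    · rw [(e _).1]; ring
    · simp only [(e _).1, (e _).2, Function.comp]
      ring

/-- Both profiles equal U on (b, a), which contains c. Near every point the glued profile therefore
coincides with one of them, and the differential and entropy conditions are local. -/
theorem IsSelfSimilarSolution.glue {V W : ℝ → State} {s t : Set ℝ} {b c a : ℝ} {U : State}
    (hV : IsSelfSimilarSolution M ε k r₀ V s) (hW : IsSelfSimilarSolution M ε k r₀ W t)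
    (hbc : b < c) (hca : c < a) (hVU : ∀ y > b, V y = U) (hWU : ∀ y < a, W y = U) :
    IsSelfSimilarSolution M ε k r₀ (fun y => if y < c then V y else W y) (s ∪ t) := by
  have hloc (y : ℝ) : (fun y => if y < c then V y else W y) =ᶠ[𝓝 y] V ∨
      (fun y => if y < c then V y else W y) =ᶠ[𝓝 y] W := by
    rcases lt_or_ge y c with hy | hy
    · left
      filter_upwards [gt_mem_nhds hy] with x hx
      rw [if_pos hx]
    · right
      filter_upwards [lt_mem_nhds (hbc.trans_le hy)] with x hx
      split_ifs with h
      · rw [hVU x hx, hWU x (h.trans hca)]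
      · rfl
  have transfer (P : (ℝ → State) → Prop) (y : ℝ) (h1 : P V) (h2 : P W)
      (hP : ∀ X Y : ℝ → State, X =ᶠ[𝓝 y] Y → P Y → P X) :
      P (fun y => if y < c then V y else W y) := by
    rcases hloc y with h | h
    · exact hP _ _ h h1
    · exact hP _ _ h h2
  refine ⟨fun y => ?_, Measurable.ite measurableSet_Iio hV.measurable hW.measurable, ?_,
    fun y => ?_, fun i y => ?_, fun i y hy => ?_⟩
  · split_ifs
    exacts [hV.admissible y, hW.admissible y]
  · obtain ⟨C, hC⟩ := hV.bounded
    obtain ⟨D, hD⟩ := hW.bounded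
    refine ⟨max C D, fun y i => ?_⟩
    split_ifs
    · exact ⟨(hC y i).1.trans (le_max_left _ _), (hC y i).2.trans (le_max_left _ _)⟩
    · exact ⟨(hD y i).1.trans (le_max_right _ _), (hD y i).2.trans (le_max_right _ _)⟩
  · refine transfer (fun X => ContinuousAt X y ∨ ∃ A B, Admissible ε A ∧ Admissible ε B ∧
      Filter.Tendsto X (𝓝[<] y) (𝓝 A) ∧ Filter.Tendsto X (𝓝[>] y) (𝓝 B) ∧
      (IsShock₁ M ε k r₀ y A B ∨ IsShock₂ M ε k r₀ y A B)) y (hV.entropy y) (hW.entropy y) ?_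
    rintro X Y hXY (hc | ⟨A, B, hA, hB, hl, hr, hsh⟩)
    · exact Or.inl (hc.congr hXY.symm)
    · exact Or.inr ⟨A, B, hA, hB, hl.congr' (hXY.filter_mono nhdsWithin_le_nhds).symm,
        hr.congr' (hXY.filter_mono nhdsWithin_le_nhds).symm, hsh⟩
  · refine transfer (fun X => ContinuousAt
      (fun y => flux M ε k r₀ (X y) i - y * conserved M ε k r₀ (X y) i) y) y
      (hV.continuousAt i y) (hW.continuousAt i y) fun X Y hXY h => h.congr ?_
    filter_upwards [hXY] with x hx
    rw [hx]
  · rw [Set.mem_union, not_or] at hy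
    refine transfer (fun X => HasDerivAt
      (fun y => flux M ε k r₀ (X y) i - y * conserved M ε k r₀ (X y) i)
      (-conserved M ε k r₀ (X y) i) y) y
      (hV.hasDerivAt i y hy.1) (hW.hasDerivAt i y hy.2) fun X Y hXY h => ?_
    rw [hXY.eq_of_nhds]
    refine h.congr_of_eventuallyEq ?_
    filter_upwards [hXY] with x hx
    rw [hx]

theorem hasDerivAt_flux_sub_const (A : State) (i : Fin 2) (y : ℝ) :
    HasDerivAt (fun y => flux M ε k r₀ A i - y * conserved M ε k r₀ A i)
      (-conserved M ε k r₀ A i) y := by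
  simpa using ((hasDerivAt_id y).mul_const (conserved M ε k r₀ A i)).const_sub (flux M ε k r₀ A i)

/-- A Lax shock as a piecewise constant self-similar solution. -/
theorem isSelfSimilarSolution_shock {σ : ℝ} {A B : State} (hA : Admissible ε A)
    (hB : Admissible ε B) (h : IsShock₁ M ε k r₀ σ A B) :
    IsSelfSimilarSolution M ε k r₀ (fun y => if y < σ then A else B) {σ} := by
  have hlt {y : ℝ} (hy : y < σ) : (fun y => if y < σ then A else B) =ᶠ[𝓝 y] fun _ => A := by
    filter_upwards [gt_mem_nhds hy] with x hx
    rw [if_pos hx]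
  have hgt {y : ℝ} (hy : σ < y) : (fun y => if y < σ then A else B) =ᶠ[𝓝 y] fun _ => B := by
    filter_upwards [lt_mem_nhds hy] with x hx
    rw [if_neg hx.not_gt]
  have hder (i : Fin 2) (y : ℝ) (hy : y ∉ ({σ} : Set ℝ)) : HasDerivAt (fun y =>
      flux M ε k r₀ (if y < σ then A else B) i - y * conserved M ε k r₀ (if y < σ then A else B) i)
      (-conserved M ε k r₀ (if y < σ then A else B) i) y := by
    rcases lt_or_gt_of_ne hy with hy | hy
    · rw [if_pos hy]
      refine (hasDerivAt_flux_sub_const A i y).congr_of_eventuallyEq ?_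
      filter_upwards [hlt hy] with x hx
      simp only [hx]
    · rw [if_neg hy.not_gt]
      refine (hasDerivAt_flux_sub_const B i y).congr_of_eventuallyEq ?_
      filter_upwards [hgt hy] with x hx
      simp only [hx]
  refine ⟨fun y => ?_, Measurable.ite measurableSet_Iio measurable_const measurable_const, ?_,
    fun y => ?_, fun i y => ?_, hder⟩
  · split_ifs
    exacts [hA, hB]
  · refine ⟨∑ i, (|conserved M ε k r₀ A i| + |flux M ε k r₀ A i| + |conserved M ε k r₀ B i|
      + |flux M ε k r₀ B i|), fun y i => ?_⟩
    have := Finset.single_le_sum (f := fun i => |conserved M ε k r₀ A i| + |flux M ε k r₀ A i|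
      + |conserved M ε k r₀ B i| + |flux M ε k r₀ B i|) (fun i _ => by positivity)
      (Finset.mem_univ i)
    have p1 := abs_nonneg (conserved M ε k r₀ A i)
    have p2 := abs_nonneg (conserved M ε k r₀ B i)
    have p3 := abs_nonneg (flux M ε k r₀ A i)
    have p4 := abs_nonneg (flux M ε k r₀ B i)
    split_ifs <;> constructor <;> linarith
  · rcases lt_trichotomy y σ with hy | rfl | hy
    · exact Or.inl (continuousAt_const.congr (hlt hy).symm)
    · refine Or.inr ⟨A, B, hA, hB, tendsto_const_nhds.congr' ?_, tendsto_const_nhds.congr' ?_,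
        Or.inl h⟩
      · filter_upwards [self_mem_nhdsWithin] with x hx
        exact (if_pos hx).symm
      · filter_upwards [self_mem_nhdsWithin] with x hx
        exact (if_neg (not_lt.mpr (le_of_lt hx))).symm
    · exact Or.inl (continuousAt_const.congr (hgt hy).symm)
  · by_cases hy : y = σ
    · subst hy
      -- At the jump, the Rankine-Hugoniot relation says that F - yH takes the same value on both
      -- sides. It thus gives continuity and permits replacing < by ≤.
      have : (fun x => flux M ε k r₀ (if x < y then A else B) i
          - x * conserved M ε k r₀ (if x < y then A else B) i) = fun x => if x ≤ y then
          flux M ε k r₀ A i - x * conserved M ε k r₀ A i else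
          flux M ε k r₀ B i - x * conserved M ε k r₀ B i := by
        funext x
        rcases lt_trichotomy x y with hx | rfl | hx
        · rw [if_pos hx, if_pos hx.le]
        · rw [if_neg (lt_irrefl _), if_pos le_rfl]
          have := h.1 i
          linarith
        · rw [if_neg hx.not_gt, if_neg hx.not_ge]
      rw [this]
      refine (Continuous.if_le (by fun_prop) (by fun_prop) continuous_id continuous_const
        ?_).continuousAt
      intro x hx
      rw [show x = y from hx]
      have := h.1 i
      linarith
    · exact (hder i y hy).continuousAt

/-! ### Centered rarefactions -/

/-- The Doppler factor of the state with first wave speed `y`. -/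
def fanDoppler (M ε k r₀ y : ℝ) : ℝ := doppler ε k * speedFactor M ε r₀ y

/-- The density along the 1-rarefaction curve through `A`, at Doppler factor `E`. -/
def fanDensity (ε k : ℝ) (A : State) (E : ℝ) : ℝ :=
  A.1 * Real.exp ((rapidity ε A - 1 / 2 * Real.log E) / slope ε k)

/-- The centered 1-rarefaction through `A`, parametrized by the first wave speed. -/
def fanState (M ε k r₀ : ℝ) (A : State) (y : ℝ) : State :=
  (fanDensity ε k A (fanDoppler M ε k r₀ y), undoppler ε (fanDoppler M ε k r₀ y))

/-- The open interval of subluminal coordinate speeds. -/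
def subluminal (M ε r₀ : ℝ) : Set ℝ :=
  {y | -(1 - 2 * M / r₀) < ε * y ∧ ε * y < 1 - 2 * M / r₀}

theorem isOpen_subluminal : IsOpen (subluminal M ε r₀) := by
  have hc : Continuous fun y : ℝ => ε * y := by fun_prop
  exact (isOpen_lt continuous_const hc).inter (isOpen_lt hc continuous_const)

theorem fanDoppler_pos (hε : 0 < ε) (hk : 0 < k) (hkε : k < 1 / ε) {y : ℝ}
    (hy : y ∈ subluminal M ε r₀) : 0 < fanDoppler M ε k r₀ y :=
  mul_pos (by linarith [one_lt_doppler hε hk hkε]) (speedFactor_pos hy.1 hy.2)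

theorem admissible_fanState (hε : 0 < ε) (hk : 0 < k) (hkε : k < 1 / ε) {A : State}
    (hA : Admissible ε A) {y : ℝ} (hy : y ∈ subluminal M ε r₀) :
    Admissible ε (fanState M ε k r₀ A y) :=
  ⟨mul_pos hA.1 (Real.exp_pos _), abs_undoppler_lt hε (fanDoppler_pos hε hk hkε hy)⟩

theorem doppler_fanState (hε : 0 < ε) (hk : 0 < k) (hkε : k < 1 / ε) (A : State) {y : ℝ}
    (hy : y ∈ subluminal M ε r₀) :
    doppler ε (fanState M ε k r₀ A y).2 = fanDoppler M ε k r₀ y :=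
  doppler_undoppler hε (fanDoppler_pos hε hk hkε hy)

theorem speed₁_fanState (hε : 0 < ε) (hk : 0 < k) (hkε : k < 1 / ε) (hη : 0 < 1 - 2 * M / r₀)
    {A : State} (hA : Admissible ε A) {y : ℝ} (hy : y ∈ subluminal M ε r₀) :
    speed₁ M ε k r₀ (fanState M ε k r₀ A y) = y := by
  have hm := one_lt_doppler hε hk hkε
  rw [speed₁_eq hε hk hkε (admissible_fanState hε hk hkε hA hy), doppler_fanState hε hk hkε A hy,
    fanDoppler, mul_div_cancel_left₀ _ (by linarith), velocity_speedFactor hε hη hy.2]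

theorem invW_fanState (hε : 0 < ε) (hk : 0 < k) (hkε : k < 1 / ε) {A : State}
    (hA : Admissible ε A) {y : ℝ} (hy : y ∈ subluminal M ε r₀) :
    invW ε k (fanState M ε k r₀ A y) = invW ε k A := by
  have hK := slope_pos hε hk
  rw [invW_eq hε, invW_eq hε]
  congr 1
  rw [rapidity, doppler_fanState hε hk hkε A hy]
  simp only [fanState, fanDensity]
  rw [Real.log_mul hA.1.ne' (Real.exp_pos _).ne', Real.log_exp]
  field_simp
  ring

theorem speed₁_mem_subluminal (hε : 0 < ε) (hk : 0 < k) (hkε : k < 1 / ε)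
    (hη : 0 < 1 - 2 * M / r₀) {U : State} (hU : Admissible ε U) :
    speed₁ M ε k r₀ U ∈ subluminal M ε r₀ := by
  rw [speed₁_eq hε hk hkε hU]
  exact velocity_bounds hε hη
    (div_pos (doppler_pos hε hU.2) (by linarith [one_lt_doppler hε hk hkε]))

theorem fanState_speed₁ (hε : 0 < ε) (hk : 0 < k) (hkε : k < 1 / ε) (hη : 0 < 1 - 2 * M / r₀)
    {A U : State} (hA : Admissible ε A) (hU : Admissible ε U) (h : invW ε k U = invW ε k A) :
    fanState M ε k r₀ A (speed₁ M ε k r₀ U) = U := by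
  have hK := slope_pos hε hk
  have hy := speed₁_mem_subluminal (M := M) (r₀ := r₀) hε hk hkε hη hU
  have hF := admissible_fanState hε hk hkε hA hy
  have hW := (invW_fanState hε hk hkε hA hy).trans h.symm
  have hm := one_lt_doppler hε hk hkε
  have hr : rapidity ε (fanState M ε k r₀ A (speed₁ M ε k r₀ U)) = rapidity ε U := by
    rw [rapidity, rapidity, doppler_fanState hε hk hkε A hy, fanDoppler, speed₁_eq hε hk hkε hU,
      speedFactor_velocity hε hη (div_pos (doppler_pos hε hU.2) (by linarith)),
      mul_div_cancel₀ _ (by linarith)]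
  rw [invW_eq hε, invW_eq hε, div_left_inj' hε.ne', hr] at hW
  exact state_ext hε hF hU (mul_left_cancel₀ hK.ne' (by linarith)) hr

theorem contDiffOn_fanState (hε : 0 < ε) (hk : 0 < k) (hkε : k < 1 / ε) (A : State) :
    ContDiffOn ℝ ∞ (fanState M ε k r₀ A) (subluminal M ε r₀) := by
  have hE : ContDiffOn ℝ ∞ (fanDoppler M ε k r₀) (subluminal M ε r₀) := by
    unfold fanDoppler speedFactor
    refine contDiffOn_const.mul (ContDiffOn.div (by fun_prop) (by fun_prop) fun y hy => ?_)
    have := hy.2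
    linarith
  have hpos := fun y hy => fanDoppler_pos (M := M) (r₀ := r₀) (y := y) hε hk hkε hy
  refine ContDiffOn.prodMk ?_ ?_
  · unfold fanDensity
    refine contDiffOn_const.mul (ContDiffOn.exp (ContDiffOn.div_const (contDiffOn_const.sub
      (contDiffOn_const.mul (hE.log fun y hy => (hpos y hy).ne'))) _))
  · unfold undoppler
    refine ContDiffOn.div (hE.sub contDiffOn_const) (contDiffOn_const.mul (hE.add contDiffOn_const))
      fun y hy => ?_
    have := hpos y hy
    positivity

/-- The fan satisfies the system `F(V)' = y H(V)'`. -/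
theorem hasDerivAt_fanState (hε : 0 < ε) (hk : 0 < k) (hkε : k < 1 / ε) (hr : 0 < r₀)
    (hr₀ : 2 * M < r₀) {A : State} (hA : Admissible ε A) {y : ℝ} (hy : y ∈ subluminal M ε r₀)
    (i : Fin 2) :
    HasDerivAt (fun y => flux M ε k r₀ (fanState M ε k r₀ A y) i
        - y * conserved M ε k r₀ (fanState M ε k r₀ A y) i)
      (-conserved M ε k r₀ (fanState M ε k r₀ A y) i) y := by
  have hη : 0 < 1 - 2 * M / r₀ := by rw [sub_pos, div_lt_one hr]; exact hr₀
  have hK := slope_pos hε hk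
  have hm := one_lt_doppler hε hk hkε
  have hKm := slope_eq hε hk hkε
  have hE0 := fanDoppler_pos hε hk hkε hy
  have hS0 : 0 < speedFactor M ε r₀ y := speedFactor_pos hy.1 hy.2
  have hv := velocity_speedFactor hε hη hy.2
  have hES : fanDoppler M ε k r₀ y = doppler ε k * speedFactor M ε r₀ y := rfl
  obtain ⟨E', hE⟩ : ∃ E', HasDerivAt (fanDoppler M ε k r₀) E' y := by
    refine ⟨_, DifferentiableAt.hasDerivAt ?_⟩
    unfold fanDoppler speedFactor
    have : 1 - 2 * M / r₀ - ε * y ≠ 0 := by linarith [hy.2]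
    fun_prop (disch := assumption)
  set ρ : ℝ → ℝ := fun x => fanDensity ε k A (fanDoppler M ε k r₀ x) with hρdef
  set E := fanDoppler M ε k r₀ with hEdef
  set m := doppler ε k
  set S := speedFactor M ε r₀ y
  have hρ : HasDerivAt ρ (-(ρ y * E' / (2 * slope ε k * E y))) y := by
    have := ((((hE.log hE0.ne').const_mul (1 / 2)).const_sub (rapidity ε A)).div_const
      (slope ε k)).exp.const_mul A.1
    refine this.congr_deriv ?_
    simp only [hρdef, fanDensity]
    field_simp
  set ρ' := -(ρ y * E' / (2 * slope ε k * E y)) with hρ'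
  have hu := hρ.mul hE
  have hl := hρ.div hE hE0.ne'
  -- Constancy of w in differential form. It fixes the ratio of ρ' to E', so the explicit value of
  -- E' is never needed.
  have hE'ρ : ρ y * E' = -(2 * slope ε k) * E y * ρ' := by
    rw [hρ']; field_simp
  have h2K : 2 * slope ε k * (m ^ 2 + 1) = m ^ 2 - 1 := by rw [hKm]; field_simp
  set u' := ρ' * E y + ρ y * E'
  set l' := (ρ' * E y - ρ y * E') / E y ^ 2
  -- Here (ρE)' = (1 - 2K)Eρ' and (ρ/E)' = (1 + 2K)ρ'/E. With E = mS and 2K = (m² - 1)/(m² + 1)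
  -- these are exactly the decoupled relations.
  have jump := (jump_iff (M := M) hε hr hr₀ hm hS0 u' l' ρ').mpr ⟨by
      simp only [u']
      rw [hE'ρ, hES]
      linear_combination (-(m * S * ρ')) * h2K, by
      simp only [l']
      rw [hE'ρ, hES]
      have : m ≠ 0 := by linarith
      field_simp
      linear_combination ρ' * h2K⟩
  rw [hv] at jump
  have near : ∀ᶠ x in 𝓝 y, x ∈ subluminal M ε r₀ := isOpen_subluminal.mem_nhds hy
  have eqH : ∀ x ∈ subluminal M ε r₀, conserved M ε k r₀ (fanState M ε k r₀ A x) 0 =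
      r₀ ^ 2 * energy m (ρ x * E x) (ρ x / E x) (ρ x) := fun x hx => by
    rw [conserved_zero_eq hε hk hkε (admissible_fanState hε hk hkε hA hx),
      doppler_fanState hε hk hkε A hx]
    rfl
  have eqF : ∀ x ∈ subluminal M ε r₀, flux M ε k r₀ (fanState M ε k r₀ A x) 0 =
      r₀ * (r₀ - 2 * M) / ε * momentum m (ρ x * E x) (ρ x / E x) := fun x hx => by
    rw [flux_zero_eq hε hk hkε (admissible_fanState hε hk hkε hA hx),
      doppler_fanState hε hk hkε A hx]
    rfl
  have eqG : ∀ x ∈ subluminal M ε r₀, flux M ε k r₀ (fanState M ε k r₀ A x) 1 =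
      (r₀ - 2 * M) ^ 2 / ε ^ 2 * stress m (ρ x * E x) (ρ x / E x) (ρ x) := fun x hx => by
    rw [flux_one_eq hε hk hkε (admissible_fanState hε hk hkε hA hx),
      doppler_fanState hε hk hkε A hx]
    rfl
  have dH : HasDerivAt (fun x => conserved M ε k r₀ (fanState M ε k r₀ A x) 0)
      (r₀ ^ 2 * energy m u' l' ρ') y :=
    (((((hu.add hl).const_mul (m ^ 2 + 1)).add (hρ.const_mul (4 * m))).div_const
      (2 * (m + 1) ^ 2)).const_mul (r₀ ^ 2)).congr_of_eventuallyEq (near.mono eqH)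
  have dF : HasDerivAt (fun x => flux M ε k r₀ (fanState M ε k r₀ A x) 0)
      (r₀ * (r₀ - 2 * M) / ε * momentum m u' l') y :=
    ((((hu.sub hl).const_mul (m ^ 2 + 1)).div_const
      (2 * (m + 1) ^ 2)).const_mul (r₀ * (r₀ - 2 * M) / ε)).congr_of_eventuallyEq (near.mono eqF)
  have dG : HasDerivAt (fun x => flux M ε k r₀ (fanState M ε k r₀ A x) 1)
      ((r₀ - 2 * M) ^ 2 / ε ^ 2 * stress m u' l' ρ') y :=
    (((((hu.add hl).const_mul (m ^ 2 + 1)).sub (hρ.const_mul (4 * m))).div_const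
      (2 * (m + 1) ^ 2)).const_mul ((r₀ - 2 * M) ^ 2 / ε ^ 2)).congr_of_eventuallyEq (near.mono eqG)
  fin_cases i
  · refine (dF.sub ((hasDerivAt_id y).mul dH)).congr_deriv ?_
    simp only [id, one_mul, Fin.zero_eta]
    rw [jump.1]
    ring
  · simp only [Fin.mk_one, conserved_one_eq_flux_zero]
    refine (dG.sub ((hasDerivAt_id y).mul dF)).congr_deriv ?_
    simp only [id, one_mul]
    rw [jump.2]
    ring

/-- A 1-rarefaction wave as a continuous self-similar solution. -/
theorem isSelfSimilarSolution_rarefaction (hε : 0 < ε) (hk : 0 < k) (hkε : k < 1 / ε)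
    (hr : 0 < r₀) (hr₀ : 2 * M < r₀) {A : State} (hA : Admissible ε A) {a b : ℝ} (hab : a ≤ b)
    (ha : a ∈ subluminal M ε r₀) (hb : b ∈ subluminal M ε r₀) :
    IsSelfSimilarSolution M ε k r₀ (fun y => fanState M ε k r₀ A (max a (min b y))) {a, b} := by
  have hsub : ∀ y ∈ Set.Icc a b, y ∈ subluminal M ε r₀ := fun y hy =>
    ⟨ha.1.trans_le (mul_le_mul_of_nonneg_left hy.1 hε.le),
      (mul_le_mul_of_nonneg_left hy.2 hε.le).trans_lt hb.2⟩
  have hcl (y : ℝ) : max a (min b y) ∈ Set.Icc a b :=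
    ⟨le_max_left _ _, max_le hab (min_le_left _ _)⟩
  have hadm (y : ℝ) : Admissible ε (fanState M ε k r₀ A (max a (min b y))) :=
    admissible_fanState hε hk hkε hA (hsub _ (hcl y))
  have hcont : Continuous fun y => fanState M ε k r₀ A (max a (min b y)) :=
    (contDiffOn_fanState hε hk hkε A).continuousOn.comp_continuous (by fun_prop)
      fun y => hsub _ (hcl y)
  have hcH (i : Fin 2) : Continuous fun y =>
      conserved M ε k r₀ (fanState M ε k r₀ A (max a (min b y))) i :=
    continuous_iff_continuousAt.mpr fun y => ContinuousAt.comp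
      (f := fun y => fanState M ε k r₀ A (max a (min b y)))
      (continuousAt_conserved hε (hadm y) i) hcont.continuousAt
  have hcF (i : Fin 2) : Continuous fun y =>
      flux M ε k r₀ (fanState M ε k r₀ A (max a (min b y))) i :=
    continuous_iff_continuousAt.mpr fun y => ContinuousAt.comp
      (f := fun y => fanState M ε k r₀ A (max a (min b y)))
      (continuousAt_flux hε (hadm y) i) hcont.continuousAt
  -- Clamping is idempotent, so a bound on [a, b] holds on the whole line.
  have hcl2 (y : ℝ) : max a (min b (max a (min b y))) = max a (min b y) := by
    rw [min_eq_right (hcl y).2, max_eq_right (hcl y).1]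
  refine ⟨hadm, hcont.measurable, ?_, fun y => Or.inl hcont.continuousAt, fun i y => ?_,
    fun i y hy => ?_⟩
  · choose C hC using fun i => (isCompact_Icc (a := a) (b := b)).exists_bound_of_continuousOn
      (hcH i).continuousOn
    choose D hD using fun i => (isCompact_Icc (a := a) (b := b)).exists_bound_of_continuousOn
      (hcF i).continuousOn
    refine ⟨max (max (C 0) (C 1)) (max (D 0) (D 1)), fun y i => ?_⟩
    have h1 := hC i _ (hcl y)
    have h2 := hD i _ (hcl y)
    rw [hcl2, Real.norm_eq_abs] at h1 h2
    have h3 : C i ≤ max (C 0) (C 1) := by fin_cases i <;> simp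
    have h4 : D i ≤ max (D 0) (D 1) := by fin_cases i <;> simp
    exact ⟨(h1.trans h3).trans (le_max_left _ _), (h2.trans h4).trans (le_max_right _ _)⟩
  · exact ((hcF i).sub (continuous_id.mul (hcH i))).continuousAt
  · simp only [Set.mem_insert_iff, Set.mem_singleton_iff, not_or] at hy
    rcases lt_or_gt_of_ne hy.1 with h1 | h1
    · have e : ∀ x < a, max a (min b x) = a := fun x hx =>
        max_eq_left ((min_le_right _ _).trans hx.le)
      rw [e y h1]
      refine (hasDerivAt_flux_sub_const _ i y).congr_of_eventuallyEq ?_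
      filter_upwards [gt_mem_nhds h1] with x hx
      rw [e x hx]
    rcases lt_or_gt_of_ne hy.2 with h2 | h2
    · have e : ∀ x, a < x → x < b → max a (min b x) = x := fun x hx hx' => by
        rw [min_eq_right hx'.le, max_eq_right hx.le]
      rw [e y h1 h2]
      refine (hasDerivAt_fanState hε hk hkε hr hr₀ hA (hsub y ⟨h1.le, h2.le⟩)
        i).congr_of_eventuallyEq ?_
      filter_upwards [lt_mem_nhds h1, gt_mem_nhds h2] with x hx hx'
      rw [e x hx hx']
    · have e : ∀ x, b < x → max a (min b x) = b := fun x hx => by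
        rw [min_eq_left hx.le, max_eq_right hab]
      rw [e y h2]
      refine (hasDerivAt_flux_sub_const _ i y).congr_of_eventuallyEq ?_
      filter_upwards [lt_mem_nhds h2] with x hx
      rw [e x hx]

/-! ### Existence of each wave and assembly -/

/-- The upper bound on b is what later separates the two waves. For a shock it is the inequality S <
e of `shock_necessary`; for a fan it holds because the last speed has factor E/m < E. -/
theorem exists_wave₁ (hε : 0 < ε) (hk : 0 < k) (hkε : k < 1 / ε)
    (hr : 0 < r₀) (hr₀ : 2 * M < r₀) {A B : State} (hA : Admissible ε A)
    (hB : B ∈ waveCurve₁ M ε k r₀ A) :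
    ∃ (a b : ℝ) (V : ℝ → State) (s : Set ℝ), a ≤ b ∧ b < (1 - 2 * M / r₀) * B.2 ∧
      (∀ y < a, V y = A) ∧ (∀ y > b, V y = B) ∧ IsWave₁ M ε k r₀ A B a b V ∧ s.Countable ∧
      IsSelfSimilarSolution M ε k r₀ V s := by
  have hη : 0 < 1 - 2 * M / r₀ := by rw [sub_pos, div_lt_one hr]; exact hr₀
  have hBa : Admissible ε B := ((mem_waveCurve₁_iff hε hk hkε hr hr₀ hA).mp hB).1
  -- The base point is treated as a fan of zero width.
  have hor : (∃ s, IsShock₁ M ε k r₀ s A B) ∨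
      invW ε k B = invW ε k A ∧ speed₁ M ε k r₀ A ≤ speed₁ M ε k r₀ B := by
    rcases hB with (rfl | ⟨-, h⟩) | ⟨-, h1, h2⟩
    · exact Or.inr ⟨rfl, le_rfl⟩
    · exact Or.inl h
    · exact Or.inr ⟨h1, h2.le⟩
  rw [← velocity_doppler hε hBa.2]
  rcases hor with ⟨σ, hσ⟩ | ⟨hW, hle⟩
  · refine ⟨σ, σ, fun y => if y < σ then A else B, {σ}, le_rfl,
      (compression_of_isShock₁ hε hk hkε hr hr₀ hA hBa hσ).1, fun y hy => if_pos hy,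
      fun y hy => if_neg (not_lt.mpr (le_of_lt hy)), Or.inl ⟨rfl, hσ⟩, Set.countable_singleton _,
      isSelfSimilarSolution_shock hA hBa hσ⟩
  · have ha := speed₁_mem_subluminal (M := M) (r₀ := r₀) hε hk hkε hη hA
    have hb := speed₁_mem_subluminal (M := M) (r₀ := r₀) hε hk hkε hη hBa
    have hfa := fanState_speed₁ (M := M) (r₀ := r₀) hε hk hkε hη hA hA rfl
    have hfb := fanState_speed₁ (M := M) (r₀ := r₀) hε hk hkε hη hA hBa hW
    have hEB := doppler_pos hε hBa.2
    have hm := one_lt_doppler hε hk hkε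
    refine ⟨speed₁ M ε k r₀ A, speed₁ M ε k r₀ B, fun y => fanState M ε k r₀ A
      (max (speed₁ M ε k r₀ A) (min (speed₁ M ε k r₀ B) y)), _, hle, ?_, fun y hy => ?_,
      fun y hy => ?_, Or.inr ⟨rfl, rfl, hle, hW, ?_, fun y hy => ?_⟩,
      (Set.toFinite _).countable, isSelfSimilarSolution_rarefaction hε hk hkε hr hr₀ hA hle ha hb⟩
    · rw [speed₁_eq hε hk hkε hBa, velocity_lt_iff hε hη (div_pos hEB (by linarith)) hEB]
      exact div_lt_self hEB hm
    · beta_reduce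
      rw [max_eq_left ((min_le_right _ _).trans hy.le), hfa]
    · beta_reduce
      rw [min_eq_left (le_of_lt hy), max_eq_right hle, hfb]
    · refine ((contDiffOn_fanState hε hk hkε A).mono ?_).congr fun y hy => by
        rw [min_eq_right hy.2, max_eq_right hy.1]
      exact fun y hy => ⟨ha.1.trans_le (mul_le_mul_of_nonneg_left hy.1 hε.le),
        (mul_le_mul_of_nonneg_left hy.2 hε.le).trans_lt hb.2⟩
    · have hy' : y ∈ subluminal M ε r₀ := ⟨ha.1.trans_le (mul_le_mul_of_nonneg_left hy.1 hε.le),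
        (mul_le_mul_of_nonneg_left hy.2 hε.le).trans_lt hb.2⟩
      beta_reduce
      rw [min_eq_right hy.2, max_eq_right hy.1]
      exact ⟨admissible_fanState hε hk hkε hA hy', invW_fanState hε hk hkε hA hy',
        speed₁_fanState hε hk hkε hη hA hy'⟩

theorem IsRarefactionFan.congr {c I : State → ℝ} {A B : State} {a b : ℝ} {V W : ℝ → State}
    (h : IsRarefactionFan ε c I A B a b V) (hVW : ∀ y ∈ Set.Icc a b, W y = V y) :
    IsRarefactionFan ε c I A B a b W := by
  obtain ⟨h1, h2, h3, h4, h5, h6⟩ := h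
  exact ⟨h1, h2, h3, h4, h5.congr hVW, fun y hy => by rw [hVW y hy]; exact h6 y hy⟩

theorem IsWave₁.reflect {A B : State} {a b : ℝ} {V : ℝ → State}
    (h : IsWave₁ M ε k r₀ (reflect B) (reflect A) a b V) :
    IsWave₂ M ε k r₀ A B (-b) (-a) (fun y => SchwarzschildFluid.reflect (V (-y))) := by
  rcases h with ⟨rfl, h⟩ | ⟨h1, h2, h3, h4, h5, h6⟩
  · exact Or.inl ⟨rfl, isShock₁_reflect.mp (by rwa [neg_neg])⟩
  · have hmem : ∀ y ∈ Set.Icc (-b) (-a), -y ∈ Set.Icc a b := fun y hy =>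
      ⟨by linarith [hy.2], by linarith [hy.1]⟩
    refine Or.inr ⟨by rw [speed₂_eq, h2], by rw [speed₂_eq, h1], by linarith,
      by rw [invZ_eq, invZ_eq, h4], ?_, fun y hy => ?_⟩
    · have hc : ContDiffOn ℝ ∞ (fun y => V (-y)) (Set.Icc (-b) (-a)) :=
        h5.comp contDiff_neg.contDiffOn hmem
      exact (contDiff_fst.prodMk contDiff_snd.neg).comp_contDiffOn hc
    · obtain ⟨e1, e2, e3⟩ := h6 (-y) (hmem y hy)
      refine ⟨admissible_reflect.mpr e1, ?_, ?_⟩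
      · rw [invZ_eq, invZ_eq, reflect_reflect, e2, h4]
      · rw [speed₂_eq, reflect_reflect, e3, neg_neg]

theorem exists_wave₂ (hε : 0 < ε) (hk : 0 < k) (hkε : k < 1 / ε)
    (hr : 0 < r₀) (hr₀ : 2 * M < r₀) {A B : State} (hB : Admissible ε B)
    (hA : A ∈ waveCurve₂ M ε k r₀ B) :
    ∃ (a b : ℝ) (V : ℝ → State) (s : Set ℝ), a ≤ b ∧ (1 - 2 * M / r₀) * A.2 < a ∧
      (∀ y < a, V y = A) ∧ (∀ y > b, V y = B) ∧ IsWave₂ M ε k r₀ A B a b V ∧ s.Countable ∧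
      IsSelfSimilarSolution M ε k r₀ V s := by
  obtain ⟨a, b, V, s, h1, h2, h3, h4, h5, h6, h7⟩ := exists_wave₁ hε hk hkε hr hr₀
    (admissible_reflect.mpr hB) (reflect_mem_waveCurve₁.mpr hA)
  refine ⟨-b, -a, fun y => reflect (V (-y)), Neg.neg ⁻¹' s, by linarith, ?_, fun y hy => ?_,
    fun y hy => ?_, h5.reflect, h6.preimage neg_injective, h7.reflect⟩
  · simp only [reflect] at h2
    linarith
  · beta_reduce
    rw [h4 (-y) (by linarith), reflect_reflect]
  · beta_reduce
    rw [h3 (-y) (by linarith), reflect_reflect]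

end SchwarzschildFluid

end

open SchwarzschildFluid in
theorem mainTheorem6 (M ε k r₀ : ℝ) (hM : 0 ≤ M) (hε : 0 < ε) (hk : 0 < k) (hkε : k < 1 / ε)
    (hr₀ : 2 * M < r₀) (UL UR : SchwarzschildFluid.State)
    (hUL : SchwarzschildFluid.Admissible ε UL) (hUR : SchwarzschildFluid.Admissible ε UR) :
    ∃ UM : SchwarzschildFluid.State,
      SchwarzschildFluid.Admissible ε UM ∧
      SchwarzschildFluid.waveCurve₁ M ε k r₀ UL ∩ SchwarzschildFluid.waveCurve₂ M ε k r₀ UR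
        = {UM} ∧
      ∃ V : ℝ → SchwarzschildFluid.State,
        SchwarzschildFluid.IsRiemannFan M ε k r₀ UL UM UR V ∧
        SchwarzschildFluid.IsEntropyWeakSolution M ε k r₀
          (SchwarzschildFluid.riemannData r₀ UL UR) (fun t r => V ((r - r₀) / t)) := by
  have hr : 0 < r₀ := by linarith
  obtain ⟨UM, hUM, hinter⟩ := exists_inter_waveCurves hε hk hkε hr hr₀ hUL hUR
  refine ⟨UM, hUM, hinter, ?_⟩
  have hmem : UM ∈ waveCurve₁ M ε k r₀ UL ∩ waveCurve₂ M ε k r₀ UR := by rw [hinter]; rfl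
  obtain ⟨a₁, b₁, V₁, s₁, h1, h1', hl1, hr1, w1, hs1, sol1⟩ :=
    exists_wave₁ hε hk hkε hr hr₀ hUL hmem.1
  obtain ⟨a₂, b₂, V₂, s₂, h2, h2', hl2, hr2, w2, hs2, sol2⟩ :=
    exists_wave₂ hε hk hkε hr hr₀ hUR hmem.2
  -- The coordinate velocity of the middle state lies strictly between the two waves and serves as
  -- the gluing point.
  set c := (1 - 2 * M / r₀) * UM.2
  have lo : ∀ y < c, (if y < c then V₁ y else V₂ y) = V₁ y := fun y hy => if_pos hy
  have hi : ∀ y, c ≤ y → (if y < c then V₁ y else V₂ y) = V₂ y := fun y hy =>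
    if_neg (not_lt.mpr hy)
  refine ⟨fun y => if y < c then V₁ y else V₂ y,
    ⟨a₁, b₁, a₂, b₂, h1, h1'.trans h2', h2, fun y hy => ?_, fun y hy => ?_, fun y hy => ?_, ?_, ?_⟩,
    (sol1.glue sol2 h1' h2' hr1 hl2).isEntropyWeakSolution (R := max (-a₁) b₂) (hs1.union hs2)
      (fun y hy => ?_) (fun y hy => ?_)⟩
  · beta_reduce
    rw [lo y (by linarith), hl1 y hy]
  · beta_reduce
    split_ifs
    exacts [hr1 y hy.1, hl2 y hy.2]
  · beta_reduce
    rw [hi y (by linarith), hr2 y hy]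
  · exact w1.imp id fun h => h.congr fun y hy => lo y (by linarith [hy.2])
  · exact w2.imp id fun h => h.congr fun y hy => hi y (by linarith [hy.1])
  · have := le_max_left (-a₁) b₂
    rw [lo y (by linarith), hl1 y (by linarith)]
  · have := le_max_right (-a₁) b₂
    rw [hi y (by linarith), hr2 y (by linarith)]
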